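/- **Setting.** Let $V=\{1,\dots,n\}$ be partitioned into $V_1,\dots,V_m$, let $r_1,\dots,r_m\in\mathbb N$, and let $\mathcal X=\{S\subseteq V: |S\cap V_i|\le r_i \text{ for all } i\}$ be the corresponding partition matroid, identified with a subset of $\{0,1\}^n$, of rank $r\ge 1$. Let $L\ge 0$, and let $\mathcal F$ be the set of monotone submodular functions $f:2^V\to\mathbb R_{\ge 0}$ with $f\le L$ on $\mathcal X$. Put $\alpha=1-1/e$. Let $I=\{(i,j,k): i\in[m],\, j\in[r_i],\, k\in V_i\}$ and $n'=|I|=\sum_i r_i|V_i|$. Let $\mathcal X'=\{x\in\{0,1\}^I:\sum_{k\in V_i}x_{i,j,k}\le 1 \text{ for all } i,j\}$, $\mathcal Y=\operatorname{conv}\mathcal X'$ and, for $0<\delta\le 1/(2\max_i|V_i|)$, $\mathcal Y_\delta=\{((1-2\delta|V_i|)y_{i,j,k}+\delta)_{(i,j,k)\in I}: y\in\mathcal Y\}$. The randomized rounding $\hat\Xi:\mathcal Y\to\mathcal X$ picks, independently for each slot $(i,j)$, the item $k\in V_i$ with probability $y_{i,j,k}$ and no item with the remaining probability, and returns the set of all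 picked items. An OCO policy $\mathcal P_{\mathcal Y_\delta}$ for a class $\mathcal R$ of reward functions is a deterministic rule giving, in round $l$, a decision $y_l\in\mathcal Y_\delta$ as a (measurable) function of $(y_s)_{s<l}$ and of the reward functions $(\rho_s)_{s<l}$ in $\mathcal R$. Fix a norm $\|\cdot\|_p$, $p\in[1,\infty]$, to measure path lengths, and $P_T\ge 0$. Define $$\mathrm{regret}_{N,P_T}(\mathcal P_{\mathcal Y_\delta})=\sup_{\rho\in\mathcal R^N}\ \sup_{y^\star}\ \Big\{\sum_{l=1}^N\rho_l(y^\star_l)-\sum_{l=1}^N\rho_l(y_l)\Big\},$$ where $y^\star$ ranges over the sequences in $\mathcal Y_\delta^N$ with $\sum_{l<N}\|y^\star_{l+1}-y^\star_l\|_p\le P_T$. **The policy LIRAOCO** (bandit feedback). Let $W\ge 1$ divide $T$, and let $\mathcal W_l=\{(l-1)W+1,\dots,lW\}$ for $l\in[T/W]$. In the window $\mathcal W_l$, let $y^\delta_l\in\mathcal Y_\delta$ be the decision of $\mathcal P_{\mathcal Y_\delta}$ after the linear rewards $\rho_s(y)=\langle y,\tilde g_s\rangle$, $s<l$. Draw independently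 $t_l$ uniformly from $\mathcal W_l$, $z$ from the density $e^{z-1}/(1-e^{-1})$ on $[0,1]$, and $v$ uniformly from the unit sphere of $\mathbb R^{I}$. At the times $t\in\mathcal W_l$, $t\ne t_l$, play $x_t=\hat\Xi(y^\delta_l)$. At the time $t_l$: * if $z\ge\frac12$: let $u=0$ with probability $\frac12$ and $u=e_c$ with probability $\frac1{2n'}$ for each $c\in I$; play $x_{t_l}=\hat\Xi\big(z(y^\delta_l+\delta\langle v,u\rangle u)\big)$ and put $\tilde\ell=2\alpha\frac{n'}{z}f_{t_l}(x_{t_l})(1-2\cdot\mathbf 1[u=0])$; * if $z<\frac12$: let $u=e_c$ with $c$ uniform on $I$; with a fair coin let $y=zy^\delta_l+\frac12u$ or $y=zy^\delta_l$; play $x_{t_l}=\hat\Xi(y)$ and put $\tilde\ell=4\alpha n'\delta\langle v,u\rangle f_{t_l}(x_{t_l})(1-2\cdot\mathbf 1[y=zy^\delta_l])$. Finally put $\tilde g_l=n'\,\tilde\ell\,\delta^{-1}v$. All draws, including those of the roundings, are independent. The dynamic $\alpha$-regret of the policy is $$\alpha\text{-}\mathrm{regret}_{T,P_T,W}=\sup_{f\in\mathcal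 F^T}\ \max_{x^\star}\ \Big\{\alpha\sum_{t=1}^Tf_t(x^\star_t)-\mathbb E\Big[\sum_{t=1}^Tf_t(x_t)\Big]\Big\},$$ where $x^\star$ ranges over the sequences in $\mathcal X^T$ that are constant on each window and satisfy $\sum_{t<T}\|x^\star_{t+1}-x^\star_t\|_p\le P_T$. **Theorem.** Let $\mathcal P_{\mathcal Y_\delta}$ be any OCO policy over $\mathcal Y_\delta$ for a class $\mathcal R$ of reward functions that contains all linear functions $y\mapsto\langle y,g\rangle$ with $\|g\|_2\le 4\alpha n'^2L/\delta$ (the rewards $\langle\cdot,\tilde g_l\rangle$ are almost surely of this form). Then LIRAOCO driven by $\mathcal P_{\mathcal Y_\delta}$ satisfies $$\alpha\text{-}\mathrm{regret}_{T,P_T,W}\ \le\ W\cdot\mathrm{regret}_{T/W,P_T}(\mathcal P_{\mathcal Y_\delta})+\frac{LT}{W}+2\alpha\delta r^2nLT .$$ -/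

import Mathlib

open MeasureTheory ProbabilityTheory
open scoped ENNReal

noncomputable section

namespace LIRAOCO

/-! ### Set functions, partition matroids -/

/-- Submodularity of a set function on `2^V`, `V = {1, …, n}`. -/
def Submodular {n : ℕ} (f : Finset (Fin n) → ℝ) : Prop :=
  ∀ (S : Finset (Fin n)) (i j : Fin n), i ∉ S → j ∉ S →
    f (S ∪ {i, j}) - f (S ∪ {j}) ≤ f (S ∪ {i}) - f S

/-- The `0/1` vector of a finite set. -/
def indVec {ι : Type*} [DecidableEq ι] (S : Finset ι) : ι → ℝ := fun k => if k ∈ S then 1 else 0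

/-- The data of a partition matroid on `V = {1, …, n}`: `V` is split into the `m` parts
`V_i = {k | part k = i}`, and at most `cap i` elements may be taken from `V_i`. -/
structure PartitionMatroid (n m : ℕ) where
  part : Fin n → Fin m
  cap : Fin m → ℕ

namespace PartitionMatroid

variable {n m : ℕ} (M : PartitionMatroid n m)

/-- The cardinality of the part `V_i`. -/
def partCard (i : Fin m) : ℕ := (Finset.univ.filter fun k => M.part k = i).card

/-- The decision set `𝒳` (as a family of subsets of `V`): the independent sets. -/
def decisions : Set (Finset (Fin n)) :=
  {S | ∀ i, (S.filter fun k => M.part k = i).card ≤ M.cap i}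

/-- The rank: the largest cardinality of an independent set. -/
def rank : ℕ := sSup {c | ∃ S ∈ M.decisions, S.card = c}

/-- The slots `(i, j)` with `1 ≤ j ≤ cap i`. -/
abbrev Slot : Type := Σ i : Fin m, Fin (M.cap i)

/-- The triples `(i, j, k)` with `k ∈ V_i` and `1 ≤ j ≤ cap i`; since `i = part k`, such a triple is
given by `k` and `j`. -/
abbrev Coord : Type := Σ k : Fin n, Fin (M.cap (M.part k))

/-- The slot `(i, j)` of the triple `(i, j, k)`. -/
def slot (c : M.Coord) : M.Slot := ⟨M.part c.1, c.2⟩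

/-- The dimension `n' = ∑ i, |V_i| * cap i` of the lifted problem. -/
def dim : ℕ := Fintype.card M.Coord

/-- The lifted decision set `𝒳'` (as a family of sets of triples): at most one element in each
slot. -/
def lifted : Set (Finset M.Coord) :=
  {A | ∀ s, (A.filter fun c => M.slot c = s).card ≤ 1}

/-- The map `𝒳' → 𝒳`: an element is selected if it sits in at least one slot. -/
def merge (A : Finset M.Coord) : Finset (Fin n) := A.image Sigma.fst

/-- `𝒴 = conv 𝒳'`. -/
def fracSet : Set (M.Coord → ℝ) := convexHull ℝ (indVec '' M.lifted)

/-- The shrunken set `𝒴_δ`. -/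
def shrunkSet (δ : ℝ) : Set (M.Coord → ℝ) :=
  (fun y c => (1 - 2 * δ * M.partCard (M.part c.1)) * y c + δ) '' M.fracSet

/-- The randomized rounding `ξ : 𝒴 → 𝒳'`, with the source of randomness `U` (one independent uniform
number of `[0, 1]` per slot): in the slot `s` the item `k` is chosen with probability `y (s, k)`, and no
item with the remaining probability. The interval `[0, 1]` is cut into consecutive intervals of
lengths `y (s, k)`, in the order of the items, and a remaining piece. -/
def round (y : M.Coord → ℝ) (U : M.Slot → ℝ) : Finset M.Coord :=
  Finset.univ.filter fun c =>
    (∑ c' with M.slot c' = M.slot c ∧ c'.1 < c.1, y c') ≤ U (M.slot c) ∧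
      U (M.slot c) < (∑ c' with M.slot c' = M.slot c ∧ c'.1 < c.1, y c') + y c

/-- The rewards: monotone submodular functions `2^V → ℝ`, nonnegative, bounded by `L` on `𝒳`. -/
def rewards (L : ℝ) : Set (Finset (Fin n) → ℝ) :=
  {f | Monotone f ∧ Submodular f ∧ (∀ S, 0 ≤ f S) ∧ ∀ S ∈ M.decisions, f S ≤ L}

end PartitionMatroid

/-! ### Online convex optimization -/

section OCO

variable {ι : Type*} [Fintype ι]

/-- The length `∑_{t < T - 1} ‖x_{t+1} - x_t‖_p` of a sequence `x_0, …, x_{T-1}`. -/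
def pathLength (p : ℝ≥0∞) (T : ℕ) (x : ℕ → ι → ℝ) : ℝ :=
  ∑ t ∈ Finset.range (T - 1), ‖WithLp.toLp p (x (t + 1) - x t)‖

/-- A (deterministic) policy over the decision set `D` for rewards in the class `R`: the decision of
round `l` is a function of the decisions and of the reward functions of the rounds before. -/
structure OCOPolicy (D : Set (ι → ℝ)) (R : Set ((ι → ℝ) → ℝ)) where
  act : (l : ℕ) → (Fin l → ι → ℝ) → (Fin l → (ι → ℝ) → ℝ) → ι → ℝ
  act_mem : ∀ l y ρ, (∀ s, y s ∈ D) → (∀ s, ρ s ∈ R) → act l y ρ ∈ D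
  /-- The decision is a measurable function of the history when the rewards are linear. -/
  measurable_act : ∀ l, Measurable fun h : (Fin l → ι → ℝ) × (Fin l → ι → ℝ) =>
    act l h.1 fun s y => y ⬝ᵥ h.2 s

variable {D : Set (ι → ℝ)} {R : Set ((ι → ℝ) → ℝ)}

/-- The decisions of the policy against the reward sequence `ρ`. -/
def OCOPolicy.decision (P : OCOPolicy D R) (ρ : ℕ → (ι → ℝ) → ℝ) (l : ℕ) : ι → ℝ :=
  P.act l (fun s => P.decision ρ s) (fun s => ρ s)
termination_by l
decreasing_by exact s.2

/-- The comparator sequences in `D` of length `T` and of path length at most `B`. -/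
def comparators (p : ℝ≥0∞) (D : Set (ι → ℝ)) (T : ℕ) (B : ℝ) : Set (ℕ → ι → ℝ) :=
  {y | (∀ t < T, y t ∈ D) ∧ pathLength p T y ≤ B}

/-- The dynamic regret of the policy over `T` rounds. -/
def OCOPolicy.regret (P : OCOPolicy D R) (p : ℝ≥0∞) (T : ℕ) (B : ℝ) : EReal :=
  ⨆ ρ ∈ {ρ : ℕ → (ι → ℝ) → ℝ | ∀ l, ρ l ∈ R}, ⨆ y ∈ comparators p D T B,
    ((∑ l ∈ Finset.range T, ρ l (y l) - ∑ l ∈ Finset.range T, ρ l (P.decision ρ l) : ℝ) : EReal)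

end OCO

/-! ### The randomness of the policy -/

/-- The approximation ratio `1 - 1/e`. -/
def ratio : ℝ := 1 - Real.exp (-1)

/-- The law on `[0, 1]` with density `exp (s - 1) / (1 - exp (-1))`. -/
def scaleLaw : Measure ℝ :=
  (volume.restrict (Set.Icc 0 1)).withDensity fun s =>
    ENNReal.ofReal (Real.exp (s - 1) / (1 - Real.exp (-1)))

/-- The uniform law on the Euclidean unit sphere: the normalized surface measure. -/
def sphereLaw (ι : Type*) [Fintype ι] : Measure (Metric.sphere (0 : EuclideanSpace ℝ ι) 1) :=
  ((volume : Measure (EuclideanSpace ℝ ι)).toSphere Set.univ)⁻¹ •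
    (volume : Measure (EuclideanSpace ℝ ι)).toSphere

variable {n m : ℕ}

/-- The random numbers drawn in one window: the exploration time, the scale `z`, the direction `v`,
a fair coin, a coordinate, and the randomness of the rounding at each time of the window. -/
abbrev Seed (M : PartitionMatroid n m) (W : ℕ) : Type :=
  Fin W × ℝ × Metric.sphere (0 : EuclideanSpace ℝ M.Coord) 1 × Bool × M.Coord ×
    (Fin W → M.Slot → ℝ)

namespace Seed

variable {M : PartitionMatroid n m} {W : ℕ} (ω : Seed M W)

/-- The exploration time. -/
def time : Fin W := ω.1
/-- The scale `z`. -/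
def z : ℝ := ω.2.1
/-- The direction `v`. -/
def v : M.Coord → ℝ := fun c => ω.2.2.1.1 c
/-- The fair coin. -/
def coin : Bool := ω.2.2.2.1
/-- The basis vector of the uniformly drawn coordinate. -/
def basisVec : M.Coord → ℝ := Pi.single ω.2.2.2.2.1 1
/-- The randomness of the rounding. -/
def U : Fin W → M.Slot → ℝ := ω.2.2.2.2.2

/-- The vector `u`. If `z ≥ 1/2`, it is `0` with probability `1/2`, and each basis vector with
probability `1/(2n')`. If `z < 1/2`, it is a uniformly drawn basis vector. -/
def u : M.Coord → ℝ := if 1 / 2 ≤ ω.z ∧ ω.coin = true then 0 else ω.basisVec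

/-- The point played at the exploration time, when the decision of the window is `y`. If
`z < 1/2`, it is `z y + u / 2` or `z y`, with probability `1/2` each. -/
def explorePoint (δ : ℝ) (y : M.Coord → ℝ) : M.Coord → ℝ :=
  if 1 / 2 ≤ ω.z then ω.z • (y + (δ * (ω.v ⬝ᵥ ω.u)) • ω.u)
  else if ω.coin = true then ω.z • y
  else ω.z • y + (1 / 2 : ℝ) • ω.u

/-- The set played at the `i`-th time of the window, when the decision of the window is `y`. -/
def play (δ : ℝ) (y : M.Coord → ℝ) (i : Fin W) : Finset (Fin n) :=
  if i = ω.time then M.merge (M.round (ω.explorePoint δ y) (ω.U i))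
  else M.merge (M.round y (ω.U i))

/-- The estimate of the directional derivative, from the reward received at the exploration
time. In both cases the sign is negative exactly if the point played is `z y`, by the choice of the
coin. -/
def derivEstimate (δ reward : ℝ) : ℝ :=
  if 1 / 2 ≤ ω.z then 2 * ratio * (M.dim / ω.z) * reward * (1 - 2 * if ω.coin = true then 1 else 0)
  else 4 * ratio * M.dim * (δ * (ω.v ⬝ᵥ ω.u)) * reward * (1 - 2 * if ω.coin = true then 1 else 0)

/-- The gradient estimate. -/
def gradEstimate (δ reward : ℝ) : M.Coord → ℝ :=
  (M.dim * ω.derivEstimate δ reward) • (δ⁻¹ • ω.v)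

end Seed

/-- The law of the random numbers of one window: all of them are independent. -/
def seedLaw (M : PartitionMatroid n m) (W : ℕ) : Measure (Seed M W) :=
  (uniformOn Set.univ).prod <| scaleLaw.prod <| (sphereLaw M.Coord).prod <|
    (uniformOn Set.univ).prod <| (uniformOn Set.univ).prod <|
      Measure.pi fun _ => Measure.pi fun _ => volume.restrict (Set.Icc 0 1)

/-! ### The policy and its regret -/

section Policy

variable {M : PartitionMatroid n m} {δ : ℝ} {R : Set ((M.Coord → ℝ) → ℝ)}

/-- The decision in `𝒴_δ` of the window `l` (the windows and the times are numbered from `0`, and the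
window `l` consists of the times `l * W + i` with `i < W`). It is the decision that the given policy `P` takes
after the linear rewards `y ↦ y ⬝ g_s`, where `g_s` is the gradient estimate of the window `s < l`,
which is obtained from the reward received at the exploration time of that window. -/
def windowDecision (P : OCOPolicy (M.shrunkSet δ) R) {N W : ℕ} (f : ℕ → Finset (Fin n) → ℝ)
    (ω : Fin N → Seed M W) (l : Fin N) : M.Coord → ℝ :=
  P.act l (fun s => windowDecision P f ω ⟨s, s.2.trans l.2⟩) fun s y =>
    y ⬝ᵥ (ω ⟨s, s.2.trans l.2⟩).gradEstimate δ
      (f (s * W + (ω ⟨s, s.2.trans l.2⟩).time) ((ω ⟨s, s.2.trans l.2⟩).play δ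
        (windowDecision P f ω ⟨s, s.2.trans l.2⟩) (ω ⟨s, s.2.trans l.2⟩).time))
termination_by l.1
decreasing_by all_goals exact s.2

/-- The total reward over `T = N * W` times. -/
def totalReward (P : OCOPolicy (M.shrunkSet δ) R) {N W : ℕ} (f : ℕ → Finset (Fin n) → ℝ)
    (ω : Fin N → Seed M W) : ℝ :=
  ∑ l : Fin N, ∑ i : Fin W, f (l * W + i) ((ω l).play δ (windowDecision P f ω l) i)

/-- The expected total reward over `T` times, a multiple of `W`. The windows are independent. -/
def expectedReward (P : OCOPolicy (M.shrunkSet δ) R) (T W : ℕ) (f : ℕ → Finset (Fin n) → ℝ) : ℝ :=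
  ∫ ω, totalReward P f ω ∂(Measure.pi fun _ : Fin (T / W) => seedLaw M W)

/-- The comparator sequences in `𝒳` of length `T` and of path length at most `B` that are constant on
each window. -/
def windowComparators (M : PartitionMatroid n m) (p : ℝ≥0∞) (T W : ℕ) (B : ℝ) :
    Set (ℕ → Finset (Fin n)) :=
  {x | (∀ t < T, x t ∈ M.decisions) ∧ pathLength p T (fun t => indVec (x t)) ≤ B ∧
    ∀ t < T, ∀ t' < T, t / W = t' / W → x t = x t'}

/-- The dynamic `α`-regret, `α = 1 - 1/e`, over `T` times, of the policy with window length `W`, against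
rewards bounded by `L`. -/
def alphaRegret (P : OCOPolicy (M.shrunkSet δ) R) (L : ℝ) (p : ℝ≥0∞) (T W : ℕ) (B : ℝ) : EReal :=
  ⨆ f ∈ {f : ℕ → Finset (Fin n) → ℝ | ∀ t, f t ∈ M.rewards L},
    ⨆ x ∈ windowComparators M p T W B,
      ((ratio * ∑ t ∈ Finset.range T, f t (x t) - expectedReward P T W f : ℝ) : EReal)

end Policy

end LIRAOCO

end

/-! Independent choices in the slots turn the expected reward of the randomized rounding into a
polynomial F, the `extension`. It is affine in each coordinate, since a coordinate enters the
weights of one slot only. For monotone submodular f, F(y) - F(x) ≤ ⟨y, ∇F(x)⟩ on fractional points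
(`Feasible.extension_sub_le`). Applying this at zx and integrating the derivative of e^(z-1) F(zx)
over [0,1] gives αF(y) - F(x) ≤ ∫ e^(z-1) ⟨y - x, ∇F(zx)⟩ dz
(`Feasible.ratio_mul_extension_sub_le`).

The right side is what the linear rewards of the windows estimate. Coordinatewise affinity makes
finite differences exact, so both branches z ≥ 1/2 and z < 1/2 average to αδ⟨v, ∇F(zy)⟩
(`Seed.average_derivEstimate`). Averaging v over the sphere, where E[v vᵀ] is the identity divided
by n', recovers the whole gradient, and the uniform exploration time averages over the window
(`integral_dotProduct_gradEstimate`). Thus W times the expected linear regret of a window bounds the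
sum of αF - F over its times. Two losses remain: the exploration time, worth at most L per window
(`le_integral_sum_play`), and replacing an independent set by its shrunken lift
(`sub_extension_shrink_le`).

The decision of a window ignores the seed of that window, so this seed can be integrated out with
the decision frozen (`expected_window_regret_le`). The rewards depend on past decisions, but the
policy is deterministic and its regret is a supremum over all reward sequences. The regret bound
therefore holds on almost every sample path (`pathwise_regret_le`). The comparator is lifted so that
each item keeps its slot while it stays selected; this does not increase its path length
(`exists_lift_sequence`, `norm_shrink_sub_le`). -/

noncomputable section

namespace LIRAOCO

/-! ### Expectations under finite product weights -/

section ProdExp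

variable {S O : Type*} [Fintype S] [DecidableEq S] [Fintype O]

/-- The expectation of `h` under the product of the (signed) weights `p s` on `O`. -/
def prodExp (p : S → O → ℝ) (h : (S → O) → ℝ) : ℝ := ∑ φ, (∏ s, p s (φ s)) * h φ

lemma prodExp_add (p : S → O → ℝ) (h k : (S → O) → ℝ) :
    prodExp p (fun φ => h φ + k φ) = prodExp p h + prodExp p k := by
  simp only [prodExp, mul_add, Finset.sum_add_distrib]

lemma prodExp_sub (p : S → O → ℝ) (h k : (S → O) → ℝ) :
    prodExp p (fun φ => h φ - k φ) = prodExp p h - prodExp p k := by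
  simp only [prodExp, mul_sub, Finset.sum_sub_distrib]

lemma prodExp_const_mul (p : S → O → ℝ) (a : ℝ) (h : (S → O) → ℝ) :
    prodExp p (fun φ => a * h φ) = a * prodExp p h := by
  simp only [prodExp, Finset.mul_sum]
  exact Finset.sum_congr rfl fun _ _ => by ring

lemma prodExp_sum {J : Type*} (t : Finset J) (p : S → O → ℝ) (h : J → (S → O) → ℝ) :
    prodExp p (fun φ => ∑ j ∈ t, h j φ) = ∑ j ∈ t, prodExp p (h j) := by
  simp only [prodExp, Finset.mul_sum]
  exact Finset.sum_comm

lemma prodExp_const {p : S → O → ℝ} (hp : ∀ s, ∑ o, p s o = 1) (a : ℝ) :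
    prodExp p (fun _ => a) = a := by
  have h := Finset.prod_univ_sum (fun _ : S => (Finset.univ : Finset O)) p
  simp only [hp, Finset.prod_const_one, Fintype.piFinset_univ] at h
  rw [prodExp, ← Finset.sum_mul, ← h, one_mul]

lemma prodExp_mono {p : S → O → ℝ} (hp : ∀ s o, 0 ≤ p s o) {h k : (S → O) → ℝ}
    (hk : ∀ φ, h φ ≤ k φ) : prodExp p h ≤ prodExp p k :=
  Finset.sum_le_sum fun φ _ =>
    mul_le_mul_of_nonneg_left (hk φ) (Finset.prod_nonneg fun s _ => hp s _)

/-- Replacing the weights of one factor amounts to resampling that factor. -/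
lemma prodExp_update {p : S → O → ℝ} {s : S} (hp : ∑ o, p s o = 1) (q : O → ℝ)
    (h : (S → O) → ℝ) :
    prodExp (Function.update p s q) h =
      prodExp p fun φ => ∑ o, q o * h (Function.update φ s o) := by
  classical
  have hw : ∀ (r : O → ℝ) (φ : S → O), ∏ t, (Function.update p s r) t (φ t) =
      r (φ s) * ∏ t ∈ Finset.univ.erase s, p t (φ t) := by
    intro r φ
    rw [← Finset.mul_prod_erase _ _ (Finset.mem_univ s), Function.update_self]
    congr 1
    refine Finset.prod_congr rfl fun t ht => ?_
    rw [Function.update_of_ne (Finset.ne_of_mem_erase ht)]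
  have hw' : ∀ φ : S → O, ∏ t, p t (φ t) =
      p s (φ s) * ∏ t ∈ Finset.univ.erase s, p t (φ t) := by
    intro φ
    rw [← hw, Function.update_eq_self]
  have he : ∀ (φ : S → O) (o : O), ∏ t ∈ Finset.univ.erase s, p t (Function.update φ s o t) =
      ∏ t ∈ Finset.univ.erase s, p t (φ t) := by
    intro φ o
    refine Finset.prod_congr rfl fun t ht => ?_
    rw [Function.update_of_ne (Finset.ne_of_mem_erase ht)]
  -- This involution exchanges the coordinate `s` of the sample with the fresh draw. After
  -- reindexing, the discarded coordinate enters only through `p s o`, which sums to one.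
  let e : (S → O) × O ≃ (S → O) × O :=
    { toFun := fun x => (Function.update x.1 s x.2, x.1 s)
      invFun := fun x => (Function.update x.1 s x.2, x.1 s)
      left_inv := fun x => by simp
      right_inv := fun x => by simp }
  have h1 : (prodExp p fun φ => ∑ o, q o * h (Function.update φ s o)) =
      ∑ x : (S → O) × O, (∏ t, p t (x.1 t)) * (q x.2 * h (Function.update x.1 s x.2)) := by
    rw [Fintype.sum_prod_type]
    simp only [prodExp, Finset.mul_sum]
  rw [h1, ← Equiv.sum_comp e, Fintype.sum_prod_type]
  refine Finset.sum_congr rfl fun φ _ => ?_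
  have h2 : ∀ o, (∏ t, p t ((e (φ, o)).1 t)) *
      (q (e (φ, o)).2 * h (Function.update (e (φ, o)).1 s (e (φ, o)).2)) =
      p s o * ((q (φ s) * ∏ t ∈ Finset.univ.erase s, p t (φ t)) * h φ) := by
    intro o
    simp only [e, Equiv.coe_fn_mk, Function.update_idem, Function.update_eq_self]
    rw [hw', he, Function.update_self]
    ring
  rw [Finset.sum_congr rfl fun o _ => h2 o, ← Finset.sum_mul, hp, one_mul, hw]

/-- The expectation of a function of one factor. -/
lemma prodExp_eval {p : S → O → ℝ} (hp : ∀ s, ∑ o, p s o = 1) (s : S) (k : O → ℝ) :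
    prodExp p (fun φ => k (φ s)) = ∑ o, p s o * k o := by
  have h := prodExp_update (hp s) (p s) fun φ => k (φ s)
  simp only [Function.update_self, Function.update_eq_self] at h
  rw [h, prodExp_const hp]

/-- The product rule differentiates one factor at a time, and a factor with weights `p' s` is a
resampling with signed weights by `prodExp_update`. -/
lemma hasDerivAt_prodExp {p : ℝ → S → O → ℝ} {p' : S → O → ℝ} {z : ℝ}
    (hp : ∀ s, ∑ o, p z s o = 1) (hd : ∀ s o, HasDerivAt (fun z => p z s o) (p' s o) z)
    (h : (S → O) → ℝ) :
    HasDerivAt (fun z => prodExp (p z) h)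
      (∑ s, prodExp (p z) fun φ => ∑ o, p' s o * h (Function.update φ s o)) z := by
  have h1 : ∀ φ : S → O, HasDerivAt (fun z => (∏ s, p z s (φ s)) * h φ)
      ((∑ s, (∏ t ∈ Finset.univ.erase s, p z t (φ t)) • p' s (φ s)) * h φ) z := fun φ =>
    (HasDerivAt.fun_finsetProd fun s _ => hd s (φ s)).mul_const _
  have h2 := HasDerivAt.fun_sum (u := Finset.univ) fun φ _ => h1 φ
  refine h2.congr_deriv ?_
  simp only [Finset.sum_mul]
  rw [Finset.sum_comm]
  refine Finset.sum_congr rfl fun s _ => ?_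
  rw [← prodExp_update (hp s)]
  refine Finset.sum_congr rfl fun φ _ => ?_
  rw [← Finset.mul_prod_erase _ _ (Finset.mem_univ s), Function.update_self, smul_eq_mul,
    mul_comm (∏ t ∈ _, _)]
  congr 2
  refine Finset.prod_congr rfl fun t ht => ?_
  rw [Function.update_of_ne (Finset.ne_of_mem_erase ht)]

end ProdExp

/-! ### Monotone submodular functions -/

section Submodular

variable {n : ℕ} {f : Finset (Fin n) → ℝ}

/-- Diminishing returns, by adding the elements of `B` to `A` one by one. Monotonicity allows `k` to
lie in `B`. -/
lemma Submodular.insert_sub_le (hf : Submodular f) (hm : Monotone f) {A B : Finset (Fin n)}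
    (hAB : A ⊆ B) (k : Fin n) : f (insert k B) - f B ≤ f (insert k A) - f A := by
  classical
  obtain ⟨D, rfl⟩ : ∃ D, B = A ∪ D := ⟨B, (Finset.union_eq_right.2 hAB).symm⟩
  clear hAB
  induction D using Finset.induction_on with
  | empty => simp
  | insert j D _ ih =>
    refine le_trans ?_ ih
    rw [Finset.union_insert]
    set C := A ∪ D
    -- Submodularity only speaks of elements outside the set. Here the left gain vanishes, and the
    -- right one is nonnegative by monotonicity.
    by_cases hk : k ∈ insert j C
    · rw [Finset.insert_eq_of_mem hk, sub_self, sub_nonneg]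
      exact hm (Finset.subset_insert _ _)
    by_cases hj : j ∈ C
    · rw [Finset.insert_eq_of_mem hj]
    have hk' : k ∉ C := fun h => hk (Finset.mem_insert_of_mem h)
    have := hf C k j hk' hj
    have e1 : C ∪ {k, j} = insert k (insert j C) := by ext; simp
    have e2 : C ∪ {j} = insert j C := by ext; simp
    have e3 : C ∪ {k} = insert k C := by ext; simp
    rwa [e1, e2, e3] at this

end Submodular

namespace PartitionMatroid

variable {n m : ℕ} (M : PartitionMatroid n m) {f : Finset (Fin n) → ℝ}

lemma merge_mono {A B : Finset M.Coord} (h : A ⊆ B) : M.merge A ⊆ M.merge B :=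
  Finset.image_subset_image h

lemma merge_insert (c : M.Coord) (A : Finset M.Coord) :
    M.merge (insert c A) = insert c.1 (M.merge A) := Finset.image_insert _ _ _

variable {M}

lemma merge_insert_sub_le (hf : Submodular f) (hm : Monotone f) {A B : Finset M.Coord}
    (hAB : A ⊆ B) (c : M.Coord) :
    f (M.merge (insert c B)) - f (M.merge B) ≤ f (M.merge (insert c A)) - f (M.merge A) := by
  simp only [merge_insert]
  exact hf.insert_sub_le hm (M.merge_mono hAB) _

/-- Telescoping over `B`: by diminishing returns each gain is at most its value at `A`. -/
lemma merge_union_sub_le (hf : Submodular f) (hm : Monotone f) (A B : Finset M.Coord) :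
    f (M.merge (A ∪ B)) - f (M.merge A) ≤
      ∑ c ∈ B, (f (M.merge (insert c A)) - f (M.merge A)) := by
  classical
  induction B using Finset.induction_on with
  | empty => simp
  | insert c B hc ih =>
    rw [Finset.union_insert, Finset.sum_insert hc]
    have := merge_insert_sub_le (M := M) hf hm (Finset.subset_union_left (s₁ := A) (s₂ := B)) c
    linarith

variable (M)

/-! ### The multilinear extension of the lifted problem -/

/-- The law of the choice made in the slot `s`, when the marginals are `y`. -/
def slotWeight (y : M.Coord → ℝ) (s : M.Slot) : Option M.Coord → ℝ
  | some c => if M.slot c = s then y c else 0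
  | none => 1 - ∑ c with M.slot c = s, y c

/-- The triples selected by a choice in each slot. -/
def chosen (φ : M.Slot → Option M.Coord) : Finset M.Coord :=
  Finset.univ.filter fun c => φ (M.slot c) = some c

/-- The expectation of `f` at the randomized rounding of `y`, as a polynomial in `y`. -/
def extension (f : Finset (Fin n) → ℝ) (y : M.Coord → ℝ) : ℝ :=
  prodExp (M.slotWeight y) fun φ => f (M.merge (M.chosen φ))

/-- The partial derivatives of `extension`. -/
def extensionGrad (f : Finset (Fin n) → ℝ) (y : M.Coord → ℝ) (c : M.Coord) : ℝ :=
  prodExp (M.slotWeight y) fun φ =>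
    f (M.merge (insert c ((M.chosen φ).filter fun c' => M.slot c' ≠ M.slot c))) -
      f (M.merge ((M.chosen φ).filter fun c' => M.slot c' ≠ M.slot c))

/-- The fractional points: nonnegative vectors whose sum over each slot is at most one. -/
def Feasible (y : M.Coord → ℝ) : Prop :=
  (∀ c, 0 ≤ y c) ∧ ∀ s, ∑ c with M.slot c = s, y c ≤ 1

variable {M} {f : Finset (Fin n) → ℝ} {y x : M.Coord → ℝ}

/-- With the empty choice as base point, the mean over a slot is visibly affine in `y`. -/
lemma sum_slotWeight_mul (y : M.Coord → ℝ) (s : M.Slot) (k : Option M.Coord → ℝ) :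
    ∑ o, M.slotWeight y s o * k o =
      k none + ∑ c with M.slot c = s, y c * (k (some c) - k none) := by
  simp only [Fintype.sum_option, slotWeight, mul_sub, Finset.sum_sub_distrib, ite_mul, zero_mul,
    Finset.sum_ite, Finset.sum_const_zero, add_zero, ← Finset.sum_mul]
  ring

lemma sum_slotWeight (y : M.Coord → ℝ) (s : M.Slot) : ∑ o, M.slotWeight y s o = 1 := by
  simpa using sum_slotWeight_mul y s fun _ => 1

lemma Feasible.slotWeight_nonneg (hy : M.Feasible y) (s : M.Slot) (o : Option M.Coord) :
    0 ≤ M.slotWeight y s o := by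
  cases o with
  | none => exact sub_nonneg.2 (hy.2 s)
  | some c =>
    simp only [slotWeight]
    split_ifs
    exacts [hy.1 c, le_rfl]

lemma Feasible.smul (hy : M.Feasible y) {z : ℝ} (h0 : 0 ≤ z) (h1 : z ≤ 1) :
    M.Feasible (z • y) := by
  refine ⟨fun c => mul_nonneg h0 (hy.1 c), fun s => ?_⟩
  simp only [Pi.smul_apply, smul_eq_mul, ← Finset.mul_sum]
  exact mul_le_one₀ h1 (Finset.sum_nonneg fun c _ => hy.1 c) (hy.2 s)

lemma chosen_update_none (φ : M.Slot → Option M.Coord) (s : M.Slot) :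
    M.chosen (Function.update φ s none) = (M.chosen φ).filter fun c => M.slot c ≠ s := by
  ext c
  by_cases h : M.slot c = s
  · subst h; simp [chosen]
  · simp [chosen, h]

lemma chosen_update_some (φ : M.Slot → Option M.Coord) (c : M.Coord) :
    M.chosen (Function.update φ (M.slot c) (some c)) =
      insert c ((M.chosen φ).filter fun c' => M.slot c' ≠ M.slot c) := by
  ext c'
  by_cases h : M.slot c' = M.slot c
  · simp [chosen, h, eq_comm]
  · have : c' ≠ c := fun h' => h (h' ▸ rfl)
    simp [chosen, h, this]

/-- With `a = 1` these signed weights have mass zero: they are the derivative of the slot weights in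
the direction `d`, so only the gains over the emptied slot survive. -/
lemma sum_resample (φ : M.Slot → Option M.Coord) (s : M.Slot) (d : M.Coord → ℝ) (a : ℝ)
    (h : Finset M.Coord → ℝ) :
    (∑ o : Option M.Coord, (M.slotWeight d s o - a * if o = none then 1 else 0) *
        h (M.chosen (Function.update φ s o))) =
      (1 - a) * h (M.chosen (Function.update φ s none)) + ∑ c with M.slot c = s, d c *
        (h (insert c ((M.chosen φ).filter fun c' => M.slot c' ≠ M.slot c)) -
          h ((M.chosen φ).filter fun c' => M.slot c' ≠ M.slot c)) := by
  simp only [sub_mul, Finset.sum_sub_distrib]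
  rw [sum_slotWeight_mul d s fun o => h (M.chosen (Function.update φ s o))]
  have h1 : ∑ o : Option M.Coord, a * (if o = none then 1 else 0) *
      h (M.chosen (Function.update φ s o)) = a * h (M.chosen (Function.update φ s none)) := by
    simp
  rw [h1]
  have h2 : ∀ c ∈ Finset.univ.filter fun c => M.slot c = s,
      d c * (h (M.chosen (Function.update φ s (some c))) -
        h (M.chosen (Function.update φ s none))) =
      d c * (h (insert c ((M.chosen φ).filter fun c' => M.slot c' ≠ M.slot c)) -
          h ((M.chosen φ).filter fun c' => M.slot c' ≠ M.slot c)) := by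
    intro c hc
    obtain rfl := (Finset.mem_filter.1 hc).2
    rw [chosen_update_some, chosen_update_none]
  rw [Finset.sum_congr rfl h2]
  ring

/-- Moving one coordinate shifts mass `t` from the empty choice to `c` in a single slot. The
resulting exactness for every `t`, however large, is what makes the estimator unbiased. -/
lemma extension_add_single (f : Finset (Fin n) → ℝ) (y : M.Coord → ℝ) (c : M.Coord) (t : ℝ) :
    M.extension f (y + t • Pi.single c 1) = M.extension f y + t * M.extensionGrad f y c := by
  have hw : M.slotWeight (y + t • Pi.single c 1) =
      Function.update (M.slotWeight y) (M.slot c)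
        (fun o => M.slotWeight y (M.slot c) o +
          t * (M.slotWeight (Pi.single c 1) (M.slot c) o - 1 * if o = none then 1 else 0)) := by
    funext s o
    by_cases h : s = M.slot c
    · subst h
      rw [Function.update_self]
      cases o with
      | none =>
        simp only [slotWeight, Pi.add_apply, Pi.smul_apply, smul_eq_mul, Finset.sum_add_distrib,
          ← Finset.mul_sum, if_true]
        ring
      | some c' =>
        simp only [slotWeight, Pi.add_apply, Pi.smul_apply, smul_eq_mul]
        split_ifs <;> simp_all
    · rw [Function.update_of_ne h]
      have h' : ∀ c', M.slot c' = s → c' ≠ c := fun c' h1 h2 => h (by rw [← h1, h2])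
      cases o with
      | none =>
        simp only [slotWeight]
        congr 1
        refine Finset.sum_congr rfl fun c' hc' => ?_
        simp [h' c' (Finset.mem_filter.1 hc').2]
      | some c' =>
        simp only [slotWeight]
        split_ifs with h1
        · simp [h' c' h1]
        · rfl
  rw [extension, hw, prodExp_update (sum_slotWeight _ _)]
  simp only [add_mul, Finset.sum_add_distrib, mul_assoc, ← Finset.mul_sum]
  rw [prodExp_add, prodExp_const_mul]
  congr 1
  · have h := prodExp_update (sum_slotWeight y (M.slot c)) (M.slotWeight y (M.slot c))
      fun φ => f (M.merge (M.chosen φ))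
    rw [Function.update_eq_self] at h
    exact h.symm
  · congr 1
    rw [extensionGrad]
    congr 1
    funext φ
    rw [sum_resample φ (M.slot c) (Pi.single c 1) 1 fun A => f (M.merge A)]
    rw [Finset.sum_eq_single c]
    · simp
    · intro b _ hb; simp [hb]
    · simp

/-- Along a ray all slots move at once; each contributes its own coordinates, by `sum_resample`. -/
lemma hasDerivAt_extension_smul (f : Finset (Fin n) → ℝ) (y : M.Coord → ℝ) (z : ℝ) :
    HasDerivAt (fun z : ℝ => M.extension f (z • y))
      (∑ c, y c * M.extensionGrad f (z • y) c) z := by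
  have h := hasDerivAt_prodExp (p := fun z => M.slotWeight (z • y))
    (p' := fun s o => M.slotWeight y s o - 1 * if o = none then 1 else 0) (z := z)
    (fun s => sum_slotWeight _ s) (by
      intro s o
      cases o with
      | none =>
        simp only [slotWeight, Pi.smul_apply, smul_eq_mul, ← Finset.mul_sum]
        have := ((hasDerivAt_id z).mul_const (∑ c with M.slot c = s, y c)).const_sub 1
        refine this.congr_deriv ?_
        simp
      | some c =>
        simp only [slotWeight, Pi.smul_apply, smul_eq_mul, reduceCtorEq, if_false, mul_zero,
          sub_zero]
        split_ifs with h1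
        · simpa using (hasDerivAt_id z).mul_const (y c)
        · simpa using hasDerivAt_const z (0 : ℝ)) fun φ => f (M.merge (M.chosen φ))
  refine h.congr_deriv ?_
  have h2 : ∀ s, (prodExp (M.slotWeight (z • y)) fun φ => ∑ o,
      (M.slotWeight y s o - 1 * if o = none then 1 else 0) *
        f (M.merge (M.chosen (Function.update φ s o)))) =
      ∑ c with M.slot c = s, y c * M.extensionGrad f (z • y) c := by
    intro s
    simp only [extensionGrad, ← prodExp_const_mul]
    rw [← prodExp_sum]
    congr 1
    funext φ
    rw [sum_resample φ s y 1 fun A => f (M.merge A)]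
    simp
  rw [Finset.sum_congr rfl fun s _ => h2 s]
  exact Finset.sum_fiberwise _ _ _

lemma continuous_slotWeight (s : M.Slot) (o : Option M.Coord) :
    Continuous fun y => M.slotWeight y s o := by
  cases o with
  | none => simp only [slotWeight]; fun_prop
  | some c =>
    simp only [slotWeight]
    split_ifs <;> fun_prop

lemma continuous_extension (f : Finset (Fin n) → ℝ) : Continuous (M.extension f) := by
  unfold extension prodExp
  exact continuous_finsetSum _ fun φ _ =>
    (continuous_finsetProd _ fun s _ => continuous_slotWeight s _).mul continuous_const

lemma continuous_extensionGrad (f : Finset (Fin n) → ℝ) (c : M.Coord) :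
    Continuous fun y => M.extensionGrad f y c := by
  unfold extensionGrad prodExp
  exact continuous_finsetSum _ fun φ _ =>
    (continuous_finsetProd _ fun s _ => continuous_slotWeight s _).mul continuous_const

lemma Feasible.extension_nonneg (hy : M.Feasible y) (h0 : ∀ S, 0 ≤ f S) :
    0 ≤ M.extension f y :=
  Finset.sum_nonneg fun _ _ =>
    mul_nonneg (Finset.prod_nonneg fun s _ => hy.slotWeight_nonneg s _) (h0 _)

/-- The marginal probabilities of the selected set. -/
lemma prodExp_slotWeight_sum_chosen (y k : M.Coord → ℝ) :
    (prodExp (M.slotWeight y) fun φ => ∑ c ∈ M.chosen φ, k c) = ∑ c, y c * k c := by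
  simp only [chosen, Finset.sum_filter]
  rw [prodExp_sum]
  refine Finset.sum_congr rfl fun c _ => ?_
  rw [prodExp_eval (fun s => sum_slotWeight y s) (M.slot c) fun o => if o = some c then k c else 0]
  simp [slotWeight]

/-- Draw a set `B` from `y` and an independent set `A` from `x`, and bound the value of `B` by that
of `A ∪ B`. The gain over `A` is at most a sum over `B`, whose mean depends on the marginals `y`
only. -/
lemma Feasible.extension_sub_le (hm : Monotone f) (hf : Submodular f) (hy : M.Feasible y)
    (hx : M.Feasible x) :
    M.extension f y - M.extension f x ≤ ∑ c, y c * M.extensionGrad f x c := by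
  have h1 : ∀ A : Finset M.Coord, M.extension f y - f (M.merge A) ≤
      ∑ c, y c * (f (M.merge (insert c A)) - f (M.merge A)) := by
    intro A
    rw [← prodExp_slotWeight_sum_chosen, extension,
      ← prodExp_const (fun s => sum_slotWeight y s) (f (M.merge A)), ← prodExp_sub,
      prodExp_const (fun s => sum_slotWeight y s)]
    refine prodExp_mono hy.slotWeight_nonneg fun ψ => ?_
    refine le_trans ?_ (merge_union_sub_le hf hm A (M.chosen ψ))
    exact sub_le_sub_right (hm (M.merge_mono Finset.subset_union_right)) _
  rw [← prodExp_const (fun s => sum_slotWeight x s) (M.extension f y), extension.eq_1 M f x,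
    ← prodExp_sub]
  simp only [extensionGrad, ← prodExp_const_mul]
  rw [← prodExp_sum]
  refine prodExp_mono hx.slotWeight_nonneg fun φ => (h1 (M.chosen φ)).trans ?_
  refine Finset.sum_le_sum fun c _ => mul_le_mul_of_nonneg_left ?_ (hy.1 c)
  -- The partial derivative empties the slot of `c` first, which can only increase the gain.
  exact merge_insert_sub_le hf hm (Finset.filter_subset _ _) c

/-- The non-oblivious boosting inequality. -/
lemma Feasible.ratio_mul_extension_sub_le (hm : Monotone f) (hf : Submodular f)
    (h0 : ∀ S, 0 ≤ f S) (hy : M.Feasible y) (hx : M.Feasible x) :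
    ratio * M.extension f y - M.extension f x ≤
      ∫ z in (0 : ℝ)..1, Real.exp (z - 1) * ∑ c, (y c - x c) * M.extensionGrad f (z • x) c := by
  have hE : Continuous fun z : ℝ => Real.exp (z - 1) := by fun_prop
  have hF : Continuous fun z : ℝ => M.extension f (z • x) :=
    (continuous_extension f).comp (by fun_prop)
  have hG : ∀ c, Continuous fun z : ℝ => M.extensionGrad f (z • x) c := fun c =>
    (continuous_extensionGrad f c).comp (by fun_prop)
  have hS : ∀ d : M.Coord → ℝ,
      Continuous fun z : ℝ => ∑ c, d c * M.extensionGrad f (z • x) c := fun d =>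
    continuous_finsetSum _ fun c _ => continuous_const.mul (hG c)
  have hd : ∀ z : ℝ, HasDerivAt (fun z : ℝ => Real.exp (z - 1) * M.extension f (z • x))
      (Real.exp (z - 1) * M.extension f (z • x) +
        Real.exp (z - 1) * ∑ c, x c * M.extensionGrad f (z • x) c) z := by
    intro z
    have h1 : HasDerivAt (fun z : ℝ => Real.exp (z - 1)) (Real.exp (z - 1)) z := by
      simpa using ((hasDerivAt_id z).sub_const 1).exp
    exact h1.mul (hasDerivAt_extension_smul f x z)
  -- This integral is F(x) - F(0)/e; the one in `hI2` is αF(y).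
  have hI1 := intervalIntegral.integral_eq_sub_of_hasDerivAt (a := 0) (b := 1)
    (fun z _ => hd z)
    (((hE.mul hF).add (hE.mul (hS x))).intervalIntegrable 0 1)
  have hd2 : ∀ z : ℝ, HasDerivAt (fun z : ℝ => Real.exp (z - 1) * M.extension f y)
      (Real.exp (z - 1) * M.extension f y) z := by
    intro z
    simpa using (((hasDerivAt_id z).sub_const 1).exp).mul_const (M.extension f y)
  have hI2 := intervalIntegral.integral_eq_sub_of_hasDerivAt (a := 0) (b := 1)
    (fun z _ => hd2 z) ((hE.mul continuous_const).intervalIntegrable 0 1)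
  have hle : ∫ z in (0 : ℝ)..1, (Real.exp (z - 1) * M.extension f y -
      (Real.exp (z - 1) * M.extension f (z • x) +
        Real.exp (z - 1) * ∑ c, x c * M.extensionGrad f (z • x) c)) ≤
      ∫ z in (0 : ℝ)..1, Real.exp (z - 1) * ∑ c, (y c - x c) * M.extensionGrad f (z • x) c := by
    refine intervalIntegral.integral_mono_on zero_le_one
      (((hE.mul continuous_const).sub ((hE.mul hF).add (hE.mul (hS x)))).intervalIntegrable 0 1)
      ((hE.mul (hS fun c => y c - x c)).intervalIntegrable 0 1) fun z hz => ?_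
    have h2 := Feasible.extension_sub_le hm hf hy (hx.smul hz.1 hz.2)
    have h3 : ∑ c, (y c - x c) * M.extensionGrad f (z • x) c =
        ∑ c, y c * M.extensionGrad f (z • x) c - ∑ c, x c * M.extensionGrad f (z • x) c := by
      simp only [sub_mul, Finset.sum_sub_distrib]
    rw [h3, ← mul_add, ← mul_sub]
    exact mul_le_mul_of_nonneg_left (by linarith) (Real.exp_nonneg _)
  have hsub := intervalIntegral.integral_sub (μ := volume)
    ((hE.mul (continuous_const (y := M.extension f y))).intervalIntegrable 0 1)
    (((hE.mul hF).add (hE.mul (hS x))).intervalIntegrable 0 1)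
  simp only [Pi.mul_apply, Pi.add_apply] at hsub
  rw [hsub, hI1, hI2] at hle
  refine le_trans ?_ hle
  have hz : M.Feasible ((0 : ℝ) • x) := hx.smul le_rfl zero_le_one
  -- Nonnegativity of f allows the boundary term F(0)/e to be dropped.
  have h4 := mul_nonneg (Real.exp_nonneg (0 - 1)) (hz.extension_nonneg h0)
  simp only [ratio, one_smul, sub_self, Real.exp_zero, zero_sub] at *
  linarith

/-- A union bound. For each outcome the value is at least `f (M.merge A)` times one minus the number
of missed triples of `A`: by monotonicity if none is missed, and otherwise because the factor is
nonpositive. -/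
lemma Feasible.le_extension (hm : Monotone f) (h0 : ∀ S, 0 ≤ f S) (hy : M.Feasible y)
    (A : Finset M.Coord) :
    f (M.merge A) * (1 - ∑ c ∈ A, (1 - y c)) ≤ M.extension f y := by
  have h1 : f (M.merge A) * (1 - ∑ c ∈ A, (1 - y c)) =
      prodExp (M.slotWeight y) fun φ => f (M.merge A) *
        ((1 - A.card) + ∑ c ∈ M.chosen φ, if c ∈ A then 1 else 0) := by
    rw [prodExp_const_mul, prodExp_add, prodExp_const (fun s => sum_slotWeight y s),
      prodExp_slotWeight_sum_chosen]
    simp [Finset.sum_sub_distrib]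
    ring_nf
    simp
  rw [h1]
  refine prodExp_mono hy.slotWeight_nonneg fun φ => ?_
  have h2 : (∑ c ∈ M.chosen φ, if c ∈ A then (1 : ℝ) else 0) = ((M.chosen φ ∩ A).card : ℝ) := by
    simp [Finset.sum_ite_mem]
  rw [h2]
  by_cases h : A ⊆ M.chosen φ
  · rw [Finset.inter_eq_right.2 h]
    simpa using hm (M.merge_mono h)
  · refine le_trans ?_ (h0 _)
    refine mul_nonpos_of_nonneg_of_nonpos (h0 _) ?_
    have h3 : (M.chosen φ ∩ A).card < A.card := by
      refine Finset.card_lt_card (Finset.ssubset_iff_subset_ne.2 ⟨Finset.inter_subset_right, ?_⟩)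
      exact fun h' => h (Finset.inter_eq_right.1 h')
    have h4 : ((M.chosen φ ∩ A).card : ℝ) + 1 ≤ A.card := by exact_mod_cast h3
    linarith

end PartitionMatroid

/-- A function of a finite set that is cut out by measurable conditions is measurable. -/
lemma measurable_comp_filter {α C : Type*} [MeasurableSpace α] [Fintype C] [DecidableEq C]
    (q : α → C → Prop) [∀ a, DecidablePred (q a)] (hq : ∀ c, MeasurableSet {a | q a c})
    (g : Finset C → ℝ) : Measurable fun a => g (Finset.univ.filter (q a)) := by
  classical
  have h : (fun a => g (Finset.univ.filter (q a))) =
      fun a => ∑ A : Finset C, if a ∈ {a | ∀ c, c ∈ A ↔ q a c} then g A else 0 := by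
    funext a
    rw [Finset.sum_eq_single (Finset.univ.filter (q a))]
    · simp
    · intro A _ hA
      rw [if_neg]
      intro h
      exact hA (by ext c; simpa using h c)
    · simp
  rw [h]
  refine Finset.measurable_sum _ fun A _ => Measurable.ite ?_ measurable_const measurable_const
  have h2 : {a | ∀ c, c ∈ A ↔ q a c} = ⋂ c, {a | c ∈ A ↔ q a c} := by ext; simp
  rw [h2]
  refine MeasurableSet.iInter fun c => ?_
  by_cases hc : c ∈ A
  · simpa [hc] using hq c
  · simp only [hc, false_iff]
    exact (hq c).compl

namespace PartitionMatroid

variable {n m : ℕ} (M : PartitionMatroid n m)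

/-! ### The law of the randomized rounding -/

/-- The left end of the interval that belongs to the triple `c`. -/
def leftEnd (y : M.Coord → ℝ) (c : M.Coord) : ℝ :=
  ∑ c' with M.slot c' = M.slot c ∧ c'.1 < c.1, y c'

open Classical in
/-- The triple picked in the slot `s` by the rounding. -/
def picked (y : M.Coord → ℝ) (s : M.Slot) (u : ℝ) : Option M.Coord :=
  if h : ∃ c, M.slot c = s ∧ M.leftEnd y c ≤ u ∧ u < M.leftEnd y c + y c then some h.choose
  else none

variable {M} {f : Finset (Fin n) → ℝ} {y : M.Coord → ℝ}

lemma eq_of_slot_eq {c c' : M.Coord} (h : M.slot c = M.slot c') (h1 : c.1 = c'.1) : c = c' := by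
  obtain ⟨k, j⟩ := c
  obtain ⟨k', j'⟩ := c'
  obtain rfl : k = k' := h1
  simpa [slot] using h

lemma leftEnd_add_le (hy : ∀ c, 0 ≤ y c) {c c' : M.Coord} (h : M.slot c = M.slot c')
    (h1 : c.1 < c'.1) : M.leftEnd y c + y c ≤ M.leftEnd y c' := by
  have hc : c ∉ Finset.univ.filter fun c' => M.slot c' = M.slot c ∧ c'.1 < c.1 := by simp
  rw [leftEnd, add_comm, ← Finset.sum_insert hc, leftEnd]
  refine Finset.sum_le_sum_of_subset_of_nonneg ?_ fun _ _ _ => hy _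
  intro b hb
  simp only [Finset.mem_insert, Finset.mem_filter, Finset.mem_univ, true_and] at hb ⊢
  rcases hb with rfl | ⟨hb, hb'⟩
  exacts [⟨h, h1⟩, ⟨hb.trans h, hb'.trans h1⟩]

lemma eq_of_mem_interval (hy : ∀ c, 0 ≤ y c) {c c' : M.Coord} (h : M.slot c = M.slot c') {u : ℝ}
    (hc : M.leftEnd y c ≤ u ∧ u < M.leftEnd y c + y c)
    (hc' : M.leftEnd y c' ≤ u ∧ u < M.leftEnd y c' + y c') : c = c' := by
  rcases lt_trichotomy c.1 c'.1 with h1 | h1 | h1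
  · linarith [leftEnd_add_le hy h h1]
  · exact eq_of_slot_eq h h1
  · linarith [leftEnd_add_le hy h.symm h1]

lemma picked_eq_some (hy : ∀ c, 0 ≤ y c) {s : M.Slot} {u : ℝ} {c : M.Coord} :
    M.picked y s u = some c ↔ M.slot c = s ∧ M.leftEnd y c ≤ u ∧ u < M.leftEnd y c + y c := by
  unfold picked
  split_ifs with h
  · rw [Option.some_inj]
    constructor
    · rintro rfl
      exact h.choose_spec
    · rintro ⟨hs, hc⟩
      exact eq_of_mem_interval hy (h.choose_spec.1.trans hs.symm) h.choose_spec.2 hc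
  · simp only [false_iff]
    exact fun hc => h ⟨c, hc⟩

lemma round_eq_chosen (hy : ∀ c, 0 ≤ y c) (U : M.Slot → ℝ) :
    M.round y U = M.chosen fun s => M.picked y s (U s) := by
  ext c
  simp only [chosen, round, Finset.mem_filter, Finset.mem_univ, true_and, picked_eq_some hy]
  rfl

lemma round_mem_lifted (hy : ∀ c, 0 ≤ y c) (U : M.Slot → ℝ) : M.round y U ∈ M.lifted := by
  intro s
  rw [Finset.card_le_one, round_eq_chosen hy]
  simp only [chosen, Finset.mem_filter, Finset.mem_univ, true_and]
  rintro a ⟨ha, rfl⟩ b ⟨hb, h⟩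
  rw [h] at hb
  exact Option.some_inj.1 (ha.symm.trans hb)

/-- The part `i` has `cap i` slots, each supplying at most one item. -/
lemma merge_mem_decisions {A : Finset M.Coord} (hA : A ∈ M.lifted) :
    M.merge A ∈ M.decisions := by
  intro i
  have h1 : ((M.merge A).filter fun k => M.part k = i) ⊆
      (A.filter fun c => M.part c.1 = i).image Sigma.fst := by
    intro k hk
    simp only [merge, Finset.mem_filter, Finset.mem_image] at hk ⊢
    obtain ⟨⟨c, hc, rfl⟩, h⟩ := hk
    exact ⟨c, ⟨hc, h⟩, rfl⟩
  refine (Finset.card_le_card h1).trans (Finset.card_image_le.trans ?_)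
  have h2 : (A.filter fun c => M.part c.1 = i).card ≤
      ∑ j : Fin (M.cap i), (A.filter fun c => M.slot c = ⟨i, j⟩).card := by
    refine (Finset.card_le_card ?_).trans Finset.card_biUnion_le
    rintro ⟨k, j⟩ hc
    simp only [Finset.mem_filter, Finset.mem_biUnion, Finset.mem_univ, true_and] at hc ⊢
    obtain ⟨hA, rfl⟩ := hc
    exact ⟨j, hA, rfl⟩
  refine h2.trans ((Finset.sum_le_sum fun j _ => hA ⟨i, j⟩).trans ?_)
  simp

lemma measurableSet_picked (hy : ∀ c, 0 ≤ y c) (s : M.Slot) (o : Option M.Coord) :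
    MeasurableSet (M.picked y s ⁻¹' {o}) := by
  have hs : ∀ c, MeasurableSet (M.picked y s ⁻¹' {some c}) := by
    intro c
    have : M.picked y s ⁻¹' {some c} =
        {u | M.slot c = s ∧ M.leftEnd y c ≤ u ∧ u < M.leftEnd y c + y c} := by
      ext u
      simp [picked_eq_some hy]
    rw [this]
    exact (MeasurableSet.const _).inter (measurableSet_Ici.inter measurableSet_Iio)
  cases o with
  | some c => exact hs c
  | none =>
    have : M.picked y s ⁻¹' {none} = (⋃ c, M.picked y s ⁻¹' {some c})ᶜ := by
      ext u
      simp [Option.eq_none_iff_forall_ne_some]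
    rw [this]
    exact (MeasurableSet.iUnion hs).compl

instance : IsProbabilityMeasure (volume.restrict (Set.Icc (0 : ℝ) 1)) := ⟨by simp⟩

lemma Feasible.measureReal_picked (hy : M.Feasible y) (s : M.Slot) (o : Option M.Coord) :
    (volume.restrict (Set.Icc (0 : ℝ) 1)).real (M.picked y s ⁻¹' {o}) = M.slotWeight y s o := by
  have hs : ∀ c, (volume.restrict (Set.Icc (0 : ℝ) 1)).real (M.picked y s ⁻¹' {some c}) =
      M.slotWeight y s (some c) := by
    intro c
    simp only [slotWeight]
    split_ifs with h
    · have h1 : M.picked y s ⁻¹' {some c} = Set.Ico (M.leftEnd y c) (M.leftEnd y c + y c) := by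
        ext u
        simp [picked_eq_some hy.1, h]
      have h0 : 0 ≤ M.leftEnd y c := Finset.sum_nonneg fun _ _ => hy.1 _
      have h2 : M.leftEnd y c + y c ≤ 1 := by
        refine le_trans ?_ (hy.2 (M.slot c))
        have hc : c ∉ Finset.univ.filter fun c' => M.slot c' = M.slot c ∧ c'.1 < c.1 := by simp
        rw [leftEnd, add_comm, ← Finset.sum_insert hc]
        refine Finset.sum_le_sum_of_subset_of_nonneg ?_ fun _ _ _ => hy.1 _
        intro b hb
        simp only [Finset.mem_insert, Finset.mem_filter, Finset.mem_univ, true_and] at hb ⊢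
        rcases hb with rfl | ⟨hb, -⟩
        exacts [rfl, hb]
      rw [measureReal_restrict_apply (measurableSet_picked hy.1 s _), h1,
        Set.inter_eq_left.2 (show Set.Ico _ _ ⊆ Set.Icc (0 : ℝ) 1 from
          fun u hu => ⟨h0.trans hu.1, hu.2.le.trans h2⟩),
        Real.volume_real_Ico_of_le (by linarith [hy.1 c])]
      ring
    · have h1 : M.picked y s ⁻¹' {some c} = ∅ := by
        ext u
        simp [picked_eq_some hy.1, h]
      simp [h1]
  cases o with
  | some c => exact hs c
  | none =>
    -- Both laws have total mass one and agree on all triples, hence also on the empty choice.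
    have h1 := sum_measureReal_preimage_singleton (μ := volume.restrict (Set.Icc (0 : ℝ) 1))
      (f := M.picked y s) Finset.univ (fun o _ => measurableSet_picked hy.1 s o)
    rw [Finset.coe_univ, Set.preimage_univ, probReal_univ, Fintype.sum_option,
      Finset.sum_congr rfl fun c _ => hs c] at h1
    have h2 := sum_slotWeight y s
    rw [Fintype.sum_option] at h2
    linarith

/-- The expected value at the randomized rounding is the multilinear extension. -/
lemma Feasible.integral_round (hy : M.Feasible y) (f : Finset (Fin n) → ℝ) :
    ∫ U, f (M.merge (M.round y U))
      ∂(Measure.pi fun _ : M.Slot => volume.restrict (Set.Icc (0 : ℝ) 1)) =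
      M.extension f y := by
  classical
  -- Splitting by outcome leaves products of indicators, one per slot, whose integrals factor.
  have h1 : ∀ U : M.Slot → ℝ, f (M.merge (M.round y U)) =
      ∑ φ : M.Slot → Option M.Coord,
        (∏ s, (M.picked y s ⁻¹' {φ s}).indicator (1 : ℝ → ℝ) (U s)) * f (M.merge (M.chosen φ)) := by
    intro U
    rw [round_eq_chosen hy.1, Finset.sum_eq_single fun s => M.picked y s (U s)]
    · simp
    · intro φ _ hφ
      obtain ⟨s, hs⟩ := Function.ne_iff.1 hφ
      rw [Finset.prod_eq_zero (Finset.mem_univ s), zero_mul]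
      simpa using hs.symm
    · simp
  have hi : ∀ (s : M.Slot) (o : Option M.Coord), Integrable
      ((M.picked y s ⁻¹' {o}).indicator (1 : ℝ → ℝ)) (volume.restrict (Set.Icc (0 : ℝ) 1)) :=
    fun s o => (integrable_const (1 : ℝ)).indicator (measurableSet_picked hy.1 s o)
  simp only [h1]
  rw [integral_finsetSum]
  · refine Finset.sum_congr rfl fun φ _ => ?_
    rw [integral_mul_const, integral_fintype_prod_eq_prod]
    congr 1
    refine Finset.prod_congr rfl fun s _ => ?_
    rw [integral_indicator_one (measurableSet_picked hy.1 s _), hy.measureReal_picked]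
  · intro φ _
    exact (Integrable.fintype_prod fun s => hi s (φ s)).mul_const _

lemma measurable_round {α : Type*} [MeasurableSpace α] {y : α → M.Coord → ℝ}
    {U : α → M.Slot → ℝ} (hy : Measurable y) (hU : Measurable U) (g : Finset M.Coord → ℝ) :
    Measurable fun a => g (M.round (y a) (U a)) := by
  have hy' : ∀ c, Measurable fun a => y a c := fun c => (measurable_pi_apply c).comp hy
  have hU' : ∀ s, Measurable fun a => U a s := fun s => (measurable_pi_apply s).comp hU
  have hs : ∀ c, Measurable fun a =>
      ∑ c' with M.slot c' = M.slot c ∧ c'.1 < c.1, y a c' := fun c =>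
    Finset.measurable_sum _ fun c' _ => hy' c'
  unfold round
  exact measurable_comp_filter (fun a c =>
    (∑ c' with M.slot c' = M.slot c ∧ c'.1 < c.1, y a c') ≤ U a (M.slot c) ∧
      U a (M.slot c) < (∑ c' with M.slot c' = M.slot c ∧ c'.1 < c.1, y a c') + y a c)
    (fun c => (measurableSet_le (hs c) (hU' _)).inter
      (measurableSet_lt (hU' _) ((hs c).add (hy' c)))) g

end PartitionMatroid

/-! ### Second moments of the uniform law on the sphere -/

section Sphere

variable {ι : Type*} [Fintype ι]

/-- A linear isometry acts on the unit sphere. -/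
def sphereMap (e : EuclideanSpace ℝ ι ≃ₗᵢ[ℝ] EuclideanSpace ℝ ι)
    (v : Metric.sphere (0 : EuclideanSpace ℝ ι) 1) : Metric.sphere (0 : EuclideanSpace ℝ ι) 1 :=
  ⟨e v, by simp⟩

lemma measurable_sphereMap (e : EuclideanSpace ℝ ι ≃ₗᵢ[ℝ] EuclideanSpace ℝ ι) :
    Measurable (sphereMap e) :=
  (e.continuous.measurable.comp measurable_subtype_coe).subtype_mk

-- The surface measure of a set is a constant times the volume of the cone over it, and a linear
-- isometry preserves volume and carries cones to cones.
open scoped Pointwise in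
lemma measurePreserving_sphereMap (e : EuclideanSpace ℝ ι ≃ₗᵢ[ℝ] EuclideanSpace ℝ ι) :
    MeasurePreserving (sphereMap e) (sphereLaw ι) (sphereLaw ι) := by
  refine MeasurePreserving.smul_measure ⟨measurable_sphereMap e, ?_⟩ _
  ext s hs
  rw [Measure.map_apply (measurable_sphereMap e) hs,
    Measure.toSphere_apply' _ (measurable_sphereMap e hs), Measure.toSphere_apply' _ hs]
  congr 1
  rw [← e.measurePreserving.measure_preimage_emb e.toHomeomorph.measurableEmbedding
    (Set.Ioo (0 : ℝ) 1 • (Subtype.val '' s))]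
  congr 1
  ext x
  simp only [Set.mem_smul, Set.mem_image, Set.mem_preimage]
  constructor
  · rintro ⟨r, hr, _, ⟨v, hv, rfl⟩, rfl⟩
    exact ⟨r, hr, _, ⟨_, hv, rfl⟩, by simp [sphereMap]⟩
  · rintro ⟨r, hr, _, ⟨v, hv, rfl⟩, h⟩
    refine ⟨r, hr, _, ⟨sphereMap e.symm v, ?_, rfl⟩, ?_⟩
    · have : sphereMap e (sphereMap e.symm v) = v := by
        ext1
        simp [sphereMap]
      rwa [this]
    · apply e.injective
      rw [← h]
      simp [sphereMap]

instance [Nonempty ι] : IsProbabilityMeasure (sphereLaw ι) := by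
  refine ⟨?_⟩
  rw [sphereLaw, Measure.smul_apply, smul_eq_mul]
  exact ENNReal.inv_mul_cancel (Measure.measure_univ_ne_zero.2 (Measure.toSphere_ne_zero _))
    (measure_ne_top _ _)

lemma abs_sphere_apply_le (v : Metric.sphere (0 : EuclideanSpace ℝ ι) 1) (i : ι) :
    |v.1 i| ≤ 1 := by
  have h := PiLp.norm_apply_le v.1 i
  have h1 : ‖v.1‖ = 1 := by simp
  rwa [h1, Real.norm_eq_abs] at h

lemma measurable_sphere_apply (i : ι) :
    Measurable fun v : Metric.sphere (0 : EuclideanSpace ℝ ι) 1 => v.1 i := by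
  have : Continuous fun v : Metric.sphere (0 : EuclideanSpace ℝ ι) 1 => v.1 i := by fun_prop
  exact this.measurable

lemma integral_comp_sphereMap (e : EuclideanSpace ℝ ι ≃ₗᵢ[ℝ] EuclideanSpace ℝ ι)
    {g : Metric.sphere (0 : EuclideanSpace ℝ ι) 1 → ℝ} (hg : Measurable g) :
    ∫ v, g (sphereMap e v) ∂sphereLaw ι = ∫ v, g v ∂sphereLaw ι := by
  rw [← (measurePreserving_sphereMap e).map_eq, integral_map
    (measurable_sphereMap e).aemeasurable hg.aestronglyMeasurable,
    (measurePreserving_sphereMap e).map_eq]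

variable [Nonempty ι]

lemma integrable_sphere_mul (i j : ι) :
    Integrable (fun v : Metric.sphere (0 : EuclideanSpace ℝ ι) 1 => v.1 i * v.1 j)
      (sphereLaw ι) := by
  refine Integrable.of_bound
    ((measurable_sphere_apply i).mul (measurable_sphere_apply j)).aestronglyMeasurable 1
    (Filter.Eventually.of_forall fun v => ?_)
  rw [Real.norm_eq_abs, abs_mul]
  exact mul_le_one₀ (abs_sphere_apply_le v i) (abs_nonneg _) (abs_sphere_apply_le v j)

/-- Symmetry alone: swapping coordinates equates the diagonal moments, which sum to one, and
flipping the sign of one coordinate kills the mixed moments. -/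
lemma integral_sphere_mul [DecidableEq ι] (i j : ι) :
    ∫ v, v.1 i * v.1 j ∂sphereLaw ι = if i = j then (Fintype.card ι : ℝ)⁻¹ else 0 := by
  have hmeas : ∀ i j : ι, Measurable fun v : Metric.sphere (0 : EuclideanSpace ℝ ι) 1 =>
      v.1 i * v.1 j := fun i j => (measurable_sphere_apply i).mul (measurable_sphere_apply j)
  split_ifs with h
  · subst h
    have h1 : ∀ j, ∫ v, v.1 j * v.1 j ∂sphereLaw ι = ∫ v, v.1 i * v.1 i ∂sphereLaw ι := by
      intro j
      rw [← integral_comp_sphereMap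
        (LinearIsometryEquiv.piLpCongrLeft 2 ℝ ℝ (Equiv.swap i j)) (hmeas i i)]
      simp [sphereMap]
    have h2 : ∑ j, ∫ v, v.1 j * v.1 j ∂sphereLaw ι = 1 := by
      rw [← integral_finsetSum _ fun j _ => integrable_sphere_mul j j]
      have h3 : ∀ v : Metric.sphere (0 : EuclideanSpace ℝ ι) 1, ∑ j, v.1 j * v.1 j = 1 := by
        intro v
        have h4 := EuclideanSpace.real_norm_sq_eq v.1
        have h1 : ‖v.1‖ = 1 := by simp
        rw [h1] at h4
        simpa [sq] using h4.symm
      simp [h3]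
    rw [Finset.sum_congr rfl fun j _ => h1 j, Finset.sum_const, Finset.card_univ,
      nsmul_eq_mul] at h2
    exact eq_inv_of_mul_eq_one_right h2
  · have h1 := integral_comp_sphereMap
      (LinearIsometryEquiv.piLpCongrRight 2 fun k : ι => if k = i then LinearIsometryEquiv.neg ℝ
        else LinearIsometryEquiv.refl ℝ ℝ) (hmeas i j)
    simp only [sphereMap, LinearIsometryEquiv.piLpCongrRight_apply, if_true,
      if_neg (Ne.symm h), LinearIsometryEquiv.coe_neg, LinearIsometryEquiv.coe_refl, id,
      neg_mul, integral_neg] at h1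
    linarith

lemma integral_sphere_dotProduct_mul (d b : ι → ℝ) :
    ∫ v : Metric.sphere (0 : EuclideanSpace ℝ ι) 1,
      (∑ i, d i * v.1 i) * (∑ i, v.1 i * b i) ∂sphereLaw ι =
      (Fintype.card ι : ℝ)⁻¹ * ∑ i, d i * b i := by
  classical
  have h : ∀ v : Metric.sphere (0 : EuclideanSpace ℝ ι) 1,
      (∑ i, d i * v.1 i) * (∑ i, v.1 i * b i) =
        ∑ i, ∑ j, (d i * b j) * (v.1 i * v.1 j) := by
    intro v
    rw [Finset.sum_mul_sum]
    exact Finset.sum_congr rfl fun i _ => Finset.sum_congr rfl fun j _ => by ring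
  simp only [h]
  rw [integral_finsetSum _ fun i _ => integrable_finsetSum _ fun j _ =>
    (integrable_sphere_mul i j).const_mul _, Finset.mul_sum]
  refine Finset.sum_congr rfl fun i _ => ?_
  rw [integral_finsetSum _ fun j _ => (integrable_sphere_mul i j).const_mul _]
  simp only [integral_const_mul, integral_sphere_mul]
  simp [mul_comm]

end Sphere

/-! ### Lifting the comparator sequence -/

/-- Each nonzero entry of `a` is charged to its own entry of `d`; for `p = ∞` the entrywise bound
suffices. -/
lemma norm_toLp_le_of_injOn {ι κ : Type*} [Fintype ι] [Fintype κ] {p : ℝ≥0∞} (hp : 1 ≤ p)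
    (π : ι → κ) {a : ι → ℝ} {d : κ → ℝ} (hle : ∀ c, |a c| ≤ |d (π c)|)
    (hinj : Set.InjOn π {c | a c ≠ 0}) : ‖WithLp.toLp p a‖ ≤ ‖WithLp.toLp p d‖ := by
  classical
  rcases eq_or_ne p ∞ with rfl | hp'
  · rw [PiLp.norm_eq_ciSup, PiLp.norm_eq_ciSup]
    refine Real.iSup_le (fun c => ?_) (Real.iSup_nonneg fun k => norm_nonneg _)
    exact (hle c).trans (le_ciSup (f := fun k => ‖WithLp.toLp ∞ d k‖)
      (Set.finite_range _).bddAbove (π c))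
  · have hq : 0 < p.toReal := ENNReal.toReal_pos (by positivity) hp'
    rw [PiLp.norm_eq_sum hq, PiLp.norm_eq_sum hq]
    refine Real.rpow_le_rpow (Finset.sum_nonneg fun c _ => by positivity) ?_ (by positivity)
    simp only [Real.norm_eq_abs]
    calc ∑ c, |a c| ^ p.toReal = ∑ c with a c ≠ 0, |a c| ^ p.toReal := by
          refine (Finset.sum_filter_of_ne (p := fun c => a c ≠ 0) fun c _ hc h => hc ?_).symm
          rw [h, abs_zero, Real.zero_rpow hq.ne']
      _ ≤ ∑ c with a c ≠ 0, |d (π c)| ^ p.toReal :=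
          Finset.sum_le_sum fun c _ => Real.rpow_le_rpow (abs_nonneg _) (hle c) hq.le
      _ = ∑ k ∈ (Finset.univ.filter fun c => a c ≠ 0).image π, |d k| ^ p.toReal := by
          rw [Finset.sum_image]
          simpa using hinj
      _ ≤ ∑ k, |d k| ^ p.toReal :=
          Finset.sum_le_sum_of_subset_of_nonneg (Finset.subset_univ _) fun _ _ _ => by positivity

/-- A sequence constant on windows moves only at window boundaries. The step out of the window `l`
occurs at its last time `(l + 1) * W - 1`, and these times are distinct. -/
lemma pathLength_subsample_le {ι : Type*} [Fintype ι] {p : ℝ≥0∞} (hp : 1 ≤ p) {N W : ℕ}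
    (hW : 0 < W)
    {x : ℕ → ι → ℝ} (hx : ∀ t < N * W, ∀ t' < N * W, t / W = t' / W → x t = x t') :
    pathLength p N (fun l => x (l * W)) ≤ pathLength p (N * W) x := by
  classical
  have : Fact (1 ≤ p) := ⟨hp⟩
  unfold pathLength
  have hinj : Set.InjOn (fun l => (l + 1) * W - 1) (Finset.range (N - 1) : Set ℕ) := by
    intro a _ b _ h
    have h : (a + 1) * W - 1 = (b + 1) * W - 1 := h
    have ha : 0 < (a + 1) * W := by positivity
    have hb : 0 < (b + 1) * W := by positivity
    have := Nat.eq_of_mul_eq_mul_right hW (show (a + 1) * W = (b + 1) * W by omega)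
    omega
  have hlt : ∀ l ∈ Finset.range (N - 1), (l + 1) * W < N * W := by
    intro l hl
    have := Finset.mem_range.1 hl
    exact Nat.mul_lt_mul_of_pos_right (by omega) hW
  calc ∑ l ∈ Finset.range (N - 1), ‖WithLp.toLp p (x ((l + 1) * W) - x (l * W))‖
      = ∑ l ∈ Finset.range (N - 1),
          ‖WithLp.toLp p (x ((l + 1) * W - 1 + 1) - x ((l + 1) * W - 1))‖ := by
        refine Finset.sum_congr rfl fun l hl => ?_
        have h1 := hlt l hl
        have h2 : (l + 1) * W = l * W + W := by ring
        have h3 : x (l * W) = x ((l + 1) * W - 1) := by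
          refine hx _ (by omega) _ (by omega) ?_
          rw [Nat.mul_div_cancel _ hW, h2, Nat.add_sub_assoc hW, Nat.add_comm,
            Nat.add_mul_div_right _ _ hW, Nat.div_eq_of_lt (by omega), zero_add]
        rw [h3, Nat.sub_add_cancel (by omega)]
    _ = ∑ t ∈ (Finset.range (N - 1)).image (fun l => (l + 1) * W - 1),
          ‖WithLp.toLp p (x (t + 1) - x t)‖ := by
        rw [Finset.sum_image hinj]
    _ ≤ _ := by
        refine Finset.sum_le_sum_of_subset_of_nonneg ?_ fun _ _ _ => norm_nonneg _
        intro t ht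
        obtain ⟨l, hl, rfl⟩ := Finset.mem_image.1 ht
        have h1 := hlt l hl
        have h2 : 0 < (l + 1) * W := by positivity
        simp only [Finset.mem_range]
        omega

namespace PartitionMatroid

variable {n m : ℕ} {M : PartitionMatroid n m}

/-- A partial placement of an independent set into slots extends to a placement of the whole set. -/
lemma exists_lift_extending {S : Finset (Fin n)} (hS : S ∈ M.decisions) :
    ∀ (N : ℕ) (A : Finset M.Coord), (S \ M.merge A).card = N → A ∈ M.lifted →
      Set.InjOn Sigma.fst (A : Set M.Coord) → M.merge A ⊆ S →
      ∃ A' ∈ M.lifted, A ⊆ A' ∧ Set.InjOn Sigma.fst (A' : Set M.Coord) ∧ M.merge A' = S := by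
  intro N
  induction N with
  | zero =>
    intro A hN hA hinj hAS
    refine ⟨A, hA, subset_rfl, hinj, hAS.antisymm ?_⟩
    rwa [Finset.card_eq_zero, Finset.sdiff_eq_empty_iff_subset] at hN
  | succ N ih =>
    intro A hN hA hinj hAS
    obtain ⟨k, hk⟩ : (S \ M.merge A).Nonempty := by
      rw [← Finset.card_pos]
      omega
    rw [Finset.mem_sdiff] at hk
    -- Pigeonhole: if every slot of the part of `k` were taken, injectivity would give `cap`
    -- distinct items of `S` there, and `k` would be one too many.
    obtain ⟨j, hj⟩ : ∃ j : Fin (M.cap (M.part k)), ∀ c ∈ A, M.slot c ≠ ⟨M.part k, j⟩ := by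
      by_contra! h
      choose c hcA hc using h
      have hcinj : Function.Injective c := by
        intro j j' h
        have h2 := (hc j).symm.trans ((congrArg M.slot h).trans (hc j'))
        simpa using h2
      have h1 : (insert k (Finset.univ.image fun j => (c j).1)) ⊆
          S.filter fun k' => M.part k' = M.part k := by
        intro k' hk'
        rw [Finset.mem_insert, Finset.mem_image] at hk'
        rcases hk' with h | ⟨j, -, rfl⟩
        · rw [h]
          exact Finset.mem_filter.2 ⟨hk.1, rfl⟩
        · refine Finset.mem_filter.2 ⟨hAS (Finset.mem_image_of_mem _ (hcA j)), ?_⟩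
          exact congrArg Sigma.fst (hc j)
      have h2 : k ∉ Finset.univ.image fun j => (c j).1 := by
        intro h
        obtain ⟨j, -, hjk⟩ := Finset.mem_image.1 h
        have h' := Finset.mem_image_of_mem Sigma.fst (hcA j)
        rw [hjk] at h'
        exact hk.2 h'
      have h3 := (Finset.card_le_card h1).trans (hS (M.part k))
      rw [Finset.card_insert_of_notMem h2, Finset.card_image_of_injective _
        (fun j j' h => hcinj (hinj (hcA j) (hcA j') h)), Finset.card_univ, Fintype.card_fin] at h3
      omega
    have hkA : ∀ c ∈ A, c.1 ≠ k := by
      rintro c hc rfl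
      exact hk.2 (Finset.mem_image_of_mem _ hc)
    have hcard : (S \ M.merge (insert ⟨k, j⟩ A)).card = N := by
      rw [merge_insert, Finset.sdiff_insert, Finset.card_erase_of_mem (Finset.mem_sdiff.2 hk), hN]
      rfl
    have hlift : insert ⟨k, j⟩ A ∈ M.lifted := by
      intro s
      rw [Finset.filter_insert]
      split_ifs with hs
      · subst hs
        rw [Finset.filter_false_of_mem]
        · simp
        · exact fun c hc => hj c hc
      · exact hA s
    have hinj' : Set.InjOn Sigma.fst ((insert ⟨k, j⟩ A : Finset M.Coord) : Set M.Coord) := by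
      rw [Finset.coe_insert]
      refine (Set.injOn_insert ?_).2 ⟨hinj, ?_⟩
      · intro h
        exact hkA _ h rfl
      · rintro ⟨c, hc, h⟩
        exact hkA c hc h
    have hsub : M.merge (insert ⟨k, j⟩ A) ⊆ S := by
      rw [merge_insert]
      exact Finset.insert_subset hk.1 hAS
    obtain ⟨A', h1, h2, h3, h4⟩ := ih (insert ⟨k, j⟩ A) hcard hlift hinj' hsub
    exact ⟨A', h1, (Finset.subset_insert _ _).trans h2, h3, h4⟩

/-- A sequence of independent sets can be lifted in such a way that elements stay in their slots as
long as they are selected. -/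
lemma exists_lift_sequence (N : ℕ) (S : ℕ → Finset (Fin n)) (hS : ∀ l < N, S l ∈ M.decisions) :
    ∃ A : ℕ → Finset M.Coord, ∀ l < N, A l ∈ M.lifted ∧
      Set.InjOn Sigma.fst (A l : Set M.Coord) ∧ M.merge (A l) = S l ∧
      (0 < l → ∀ c ∈ A (l - 1), c.1 ∈ S l → c ∈ A l) := by
  induction N with
  | zero => exact ⟨fun _ => ∅, by simp⟩
  | succ N ih =>
    obtain ⟨A, hA⟩ := ih fun l hl => hS l (by omega)
    -- Start from the triples of the previous lift whose items are still selected, and place only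
    -- the new items.
    obtain ⟨A', h1, h2, h3, h4⟩ := exists_lift_extending (hS N (by omega)) _
      (if 0 < N then (A (N - 1)).filter fun c => c.1 ∈ S N else ∅) rfl
      (by
        split_ifs with h
        · intro s
          refine le_trans (Finset.card_le_card ?_) ((hA (N - 1) (by omega)).1 s)
          exact Finset.filter_subset_filter _ (Finset.filter_subset _ _)
        · intro s
          simp)
      (by
        split_ifs with h
        · refine (hA (N - 1) (by omega)).2.1.mono ?_
          exact_mod_cast Finset.filter_subset _ _
        · simp)
      (by
        split_ifs with h
        · intro k hk
          obtain ⟨c, hc, rfl⟩ := Finset.mem_image.1 hk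
          exact (Finset.mem_filter.1 hc).2
        · simp [merge])
    refine ⟨Function.update A N A', fun l hl => ?_⟩
    rcases Nat.lt_succ_iff_lt_or_eq.1 hl with hl' | rfl
    · rw [Function.update_of_ne hl'.ne, Function.update_of_ne (by omega)]
      exact hA l hl'
    · rw [Function.update_self]
      refine ⟨h1, h3, h4, fun h0 c hc hcS => h2 ?_⟩
      rw [Function.update_of_ne (by omega)] at hc
      rw [if_pos h0]
      exact Finset.mem_filter.2 ⟨hc, hcS⟩

variable (M)

/-- The shrinking of `fracSet` onto `shrunkSet`. -/
def shrink (δ : ℝ) (y : M.Coord → ℝ) : M.Coord → ℝ :=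
  fun c => (1 - 2 * δ * M.partCard (M.part c.1)) * y c + δ

variable {M}

lemma shrink_indVec_mem {δ : ℝ} {A : Finset M.Coord} (hA : A ∈ M.lifted) :
    M.shrink δ (indVec A) ∈ M.shrunkSet δ :=
  Set.mem_image_of_mem _ (subset_convexHull ℝ _ (Set.mem_image_of_mem _ hA))

/-- As items keep their slots, a triple changes only if its item enters or leaves, so the changed
triples have distinct items. The shift by `δ` cancels, and the factor of the shrinking is at most
one in absolute value. -/
lemma norm_shrink_sub_le {p : ℝ≥0∞} (hp : 1 ≤ p) {δ : ℝ} (hδ : 0 < δ)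
    (hδV : ∀ i, δ * (2 * M.partCard i) ≤ 1) {A A' : Finset M.Coord}
    (hA : Set.InjOn Sigma.fst (A : Set M.Coord)) (hA' : Set.InjOn Sigma.fst (A' : Set M.Coord))
    (h : ∀ c ∈ A, c.1 ∈ M.merge A' → c ∈ A') :
    ‖WithLp.toLp p (M.shrink δ (indVec A') - M.shrink δ (indVec A))‖ ≤
      ‖WithLp.toLp p (indVec (M.merge A') - indVec (M.merge A))‖ := by
  have hmem : ∀ {B : Finset M.Coord} {c : M.Coord}, c ∈ B → c.1 ∈ M.merge B :=
    fun hc => Finset.mem_image_of_mem _ hc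
  have h' : ∀ c ∈ A', c.1 ∈ M.merge A → c ∈ A := by
    intro c hc hcA
    obtain ⟨b, hb, hbc⟩ := Finset.mem_image.1 hcA
    have := h b hb (hbc ▸ hmem hc)
    rwa [← hA' this hc hbc]
  have hsub : ∀ c, (M.shrink δ (indVec A') - M.shrink δ (indVec A)) c =
      (1 - 2 * δ * M.partCard (M.part c.1)) * (indVec A' c - indVec A c) := by
    intro c
    simp only [Pi.sub_apply, shrink]
    ring
  have hcases : ∀ c, indVec A' c - indVec A c ≠ 0 →
      (c ∈ A' ∧ c.1 ∉ M.merge A) ∨ (c ∈ A ∧ c.1 ∉ M.merge A') := by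
    intro c hc
    by_cases h1 : c ∈ A' <;> by_cases h2 : c ∈ A
    · simp [indVec, h1, h2] at hc
    · exact Or.inl ⟨h1, fun h3 => h2 (h' c h1 h3)⟩
    · exact Or.inr ⟨h2, fun h3 => h1 (h c h2 h3)⟩
    · simp [indVec, h1, h2] at hc
  refine norm_toLp_le_of_injOn hp Sigma.fst (fun c => ?_) ?_
  · rw [hsub, abs_mul]
    have h1 := hδV (M.part c.1)
    have h2 : |1 - 2 * δ * M.partCard (M.part c.1)| ≤ 1 := by
      rw [abs_le]
      constructor
      · linarith
      · have : 0 ≤ 2 * δ * M.partCard (M.part c.1) := by positivity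
        linarith
    refine (mul_le_of_le_one_left (abs_nonneg _) h2).trans ?_
    by_cases hc : indVec A' c - indVec A c = 0
    · rw [hc, abs_zero]
      exact abs_nonneg _
    · rcases hcases c hc with ⟨h3, h4⟩ | ⟨h3, h4⟩
      · have h5 : c ∉ A := fun h5 => h4 (hmem h5)
        simp [indVec, h3, h4, h5, hmem h3]
      · have h5 : c ∉ A' := fun h5 => h4 (hmem h5)
        simp [indVec, h3, h4, h5, hmem h3]
  · intro c hc c' hc' hcc
    rw [Set.mem_ofPred_eq, hsub] at hc hc'
    -- The mixed cases are void: an item cannot both enter and leave.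
    rcases hcases c (right_ne_zero_of_mul hc) with ⟨h1, h2⟩ | ⟨h1, h2⟩ <;>
      rcases hcases c' (right_ne_zero_of_mul hc') with ⟨h3, h4⟩ | ⟨h3, h4⟩
    · exact hA' h1 h3 hcc
    · exact absurd (hcc ▸ hmem h3) h2
    · exact absurd (hcc ▸ hmem h3) h2
    · exact hA h1 h3 hcc

end PartitionMatroid

/-! ### Integrals against the law of the seed -/

lemma integral_uniformOn_univ {Ω : Type*} [Fintype Ω] [Nonempty Ω] [MeasurableSpace Ω]
    [MeasurableSingletonClass Ω] (g : Ω → ℝ) :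
    ∫ x, g x ∂uniformOn (Set.univ : Set Ω) = (Fintype.card Ω : ℝ)⁻¹ * ∑ x, g x := by
  rw [integral_fintype Integrable.of_finite, Finset.mul_sum]
  refine Finset.sum_congr rfl fun x _ => ?_
  rw [measureReal_def, uniformOn_univ, Measure.count_singleton]
  simp

lemma integral_prod_of_bounded {α β : Type*} [MeasurableSpace α] [MeasurableSpace β]
    (μ : Measure α) (ν : Measure β) [IsProbabilityMeasure μ] [IsProbabilityMeasure ν]
    {g : α × β → ℝ} (hg : Measurable g) {C : ℝ} (hC : ∀ x, |g x| ≤ C) :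
    ∫ x, g x ∂μ.prod ν = ∫ x, ∫ y, g (x, y) ∂ν ∂μ :=
  integral_prod _ (Integrable.of_bound hg.aestronglyMeasurable C (Filter.Eventually.of_forall hC))

lemma ratio_pos : 0 < ratio := by
  have : Real.exp (-1) < 1 := by simp
  unfold ratio
  linarith

lemma integral_scaleLaw (g : ℝ → ℝ) :
    ∫ z, g z ∂scaleLaw = ∫ z in (0 : ℝ)..1, Real.exp (z - 1) / ratio * g z := by
  rw [scaleLaw, integral_withDensity_eq_integral_toReal_smul (by fun_prop) (by simp),
    intervalIntegral.integral_of_le zero_le_one, integral_Icc_eq_integral_Ioc]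
  refine integral_congr_ae (Filter.Eventually.of_forall fun z => ?_)
  have : 0 ≤ Real.exp (z - 1) / (1 - Real.exp (-1)) :=
    div_nonneg (Real.exp_nonneg _) ratio_pos.le
  simp only [ENNReal.toReal_ofReal this, smul_eq_mul, ratio]

lemma integral_exp_sub_one : ∫ z in (0 : ℝ)..1, Real.exp (z - 1) = ratio := by
  rw [intervalIntegral.integral_comp_sub_right (fun z => Real.exp z), integral_exp]
  simp [ratio]

instance : IsProbabilityMeasure scaleLaw := by
  refine ⟨?_⟩
  have h0 : ∀ z, 0 ≤ Real.exp (z - 1) / (1 - Real.exp (-1)) := fun z =>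
    div_nonneg (Real.exp_nonneg _) ratio_pos.le
  rw [scaleLaw, withDensity_apply _ MeasurableSet.univ, Measure.restrict_univ,
    ← ofReal_integral_eq_lintegral_ofReal]
  · rw [integral_Icc_eq_integral_Ioc, ← intervalIntegral.integral_of_le zero_le_one,
      intervalIntegral.integral_div, integral_exp_sub_one]
    rw [show (1 - Real.exp (-1)) = ratio from rfl, div_self ratio_pos.ne', ENNReal.ofReal_one]
  · exact (Continuous.integrableOn_Icc (by fun_prop))
  · exact Filter.Eventually.of_forall h0

lemma scaleLaw_ae_mem : ∀ᵐ z ∂scaleLaw, z ∈ Set.Icc (0 : ℝ) 1 :=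
  (withDensity_absolutelyContinuous _ _).ae_le (ae_restrict_mem measurableSet_Icc)

variable {n m : ℕ} {M : PartitionMatroid n m} {W : ℕ}

instance : DiscreteMeasurableSpace M.Coord :=
  ⟨fun s => MeasurableSpace.measurableSet_iInf.2 fun a =>
    show MeasurableSet (Sigma.mk a ⁻¹' s) from MeasurableSet.of_discrete⟩

/-- The type of seeds allows any real scale, so feasibility of the explored points is an almost sure
statement. -/
lemma seedLaw_ae_z_mem : ∀ᵐ ω ∂seedLaw M W, ω.z ∈ Set.Icc (0 : ℝ) 1 := by
  unfold seedLaw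
  exact Measure.quasiMeasurePreserving_snd.ae
    (Measure.quasiMeasurePreserving_fst.ae scaleLaw_ae_mem)

section Law

variable [Nonempty (Fin W)] [Nonempty M.Coord]

instance : IsProbabilityMeasure (seedLaw M W) := by
  unfold seedLaw
  infer_instance

/-- The bound is required everywhere, not almost everywhere, so that it passes to every section. The
rounding is innermost, to be integrated first. -/
lemma integral_seedLaw {g : Seed M W → ℝ} (hg : Measurable g) {C : ℝ} (hC : ∀ ω, |g ω| ≤ C) :
    ∫ ω, g ω ∂seedLaw M W = (W : ℝ)⁻¹ * ∑ i, ∫ z, ∫ v, (2 : ℝ)⁻¹ * ∑ b, (M.dim : ℝ)⁻¹ * ∑ c,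
      ∫ U, g (i, z, v, b, c, U) ∂(Measure.pi fun _ : Fin W => Measure.pi fun _ : M.Slot =>
        volume.restrict (Set.Icc (0 : ℝ) 1)) ∂sphereLaw M.Coord ∂scaleLaw := by
  unfold seedLaw
  rw [integral_prod_of_bounded _ _ hg hC, integral_uniformOn_univ, Fintype.card_fin]
  congr 1
  refine Finset.sum_congr rfl fun i _ => ?_
  have h1 : Measurable fun x => g (i, x) := hg.comp measurable_prodMk_left
  rw [integral_prod_of_bounded _ _ h1 fun x => hC _]
  refine integral_congr_ae (Filter.Eventually.of_forall fun z => ?_)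
  have h2 : Measurable fun x => g (i, z, x) := h1.comp measurable_prodMk_left
  simp only
  rw [integral_prod_of_bounded _ _ h2 fun x => hC _]
  refine integral_congr_ae (Filter.Eventually.of_forall fun v => ?_)
  have h3 : Measurable fun x => g (i, z, v, x) := h2.comp measurable_prodMk_left
  simp only
  rw [integral_prod_of_bounded _ _ h3 fun x => hC _, integral_uniformOn_univ, Fintype.card_bool,
    Nat.cast_ofNat]
  congr 1
  refine Finset.sum_congr rfl fun b _ => ?_
  have h4 : Measurable fun x => g (i, z, v, b, x) := h3.comp measurable_prodMk_left
  rw [integral_prod_of_bounded _ _ h4 fun x => hC _, integral_uniformOn_univ]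
  rfl

end Law

/-! ### Measurability -/

namespace Seed

section Measurable

variable {α : Type*} [MeasurableSpace α] {σ : α → Seed M W} (hσ : Measurable σ)
include hσ

lemma measurable_time : Measurable fun a => (σ a).time := measurable_fst.comp hσ

lemma measurable_z : Measurable fun a => (σ a).z := measurable_fst.comp (measurable_snd.comp hσ)

lemma measurable_v (c : M.Coord) : Measurable fun a => (σ a).v c :=
  (measurable_sphere_apply c).comp (measurable_fst.comp (measurable_snd.comp
    (measurable_snd.comp hσ)))

lemma measurable_coin : Measurable fun a => (σ a).coin :=
  measurable_fst.comp (measurable_snd.comp (measurable_snd.comp (measurable_snd.comp hσ)))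

lemma measurable_basisVec (c : M.Coord) : Measurable fun a => (σ a).basisVec c := by
  have h : Measurable fun c' : M.Coord => (Pi.single c' (1 : ℝ) : M.Coord → ℝ) c :=
    Measurable.of_discrete
  exact h.comp (measurable_fst.comp (measurable_snd.comp (measurable_snd.comp
    (measurable_snd.comp (measurable_snd.comp hσ)))))

lemma measurable_U (i : Fin W) : Measurable fun a => (σ a).U i :=
  (measurable_pi_apply i).comp (measurable_snd.comp (measurable_snd.comp (measurable_snd.comp
    (measurable_snd.comp (measurable_snd.comp hσ)))))

lemma measurableSet_half_le_z : MeasurableSet {a | 1 / 2 ≤ (σ a).z} :=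
  measurableSet_le measurable_const (measurable_z hσ)

lemma measurableSet_coin : MeasurableSet {a | (σ a).coin = true} :=
  measurable_coin hσ (measurableSet_singleton true)

lemma measurable_u (c : M.Coord) : Measurable fun a => (σ a).u c := by
  have : (fun a => (σ a).u c) =
      fun a => if 1 / 2 ≤ (σ a).z ∧ (σ a).coin = true then 0 else (σ a).basisVec c := by
    funext a
    unfold u
    split_ifs <;> rfl
  rw [this]
  exact Measurable.ite ((measurableSet_half_le_z hσ).inter (measurableSet_coin hσ))
    measurable_const (measurable_basisVec hσ c)

lemma measurable_v_dotProduct_u : Measurable fun a => (σ a).v ⬝ᵥ (σ a).u :=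
  Finset.measurable_sum _ fun c _ => (measurable_v hσ c).mul (measurable_u hσ c)

variable {y : α → M.Coord → ℝ} (hy : Measurable y) (δ : ℝ)
include hy

lemma measurable_explorePoint : Measurable fun a => (σ a).explorePoint δ (y a) := by
  have hu : Measurable fun a => (σ a).u := measurable_pi_lambda _ fun c => measurable_u hσ c
  have hz := measurable_z hσ
  have hvu := measurable_v_dotProduct_u hσ
  unfold explorePoint
  refine Measurable.ite (measurableSet_half_le_z hσ) ?_
    (Measurable.ite (measurableSet_coin hσ) ?_ ?_) <;> fun_prop

lemma measurable_play (i : Fin W) (f : Finset (Fin n) → ℝ) :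
    Measurable fun a => f ((σ a).play δ (y a) i) := by
  have : (fun a => f ((σ a).play δ (y a) i)) = fun a => if i = (σ a).time then
      f (M.merge (M.round ((σ a).explorePoint δ (y a)) ((σ a).U i)))
      else f (M.merge (M.round (y a) ((σ a).U i))) := by
    funext a
    unfold play
    split_ifs <;> rfl
  rw [this]
  refine Measurable.ite (measurable_time hσ (measurableSet_singleton i) |>.congr ?_)
    (PartitionMatroid.measurable_round (measurable_explorePoint hσ hy δ) (measurable_U hσ i)
      fun A => f (M.merge A))
    (PartitionMatroid.measurable_round hy (measurable_U hσ i) fun A => f (M.merge A))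
  ext a
  simp [eq_comm]

lemma measurable_reward (f : Fin W → Finset (Fin n) → ℝ) :
    Measurable fun a => f (σ a).time ((σ a).play δ (y a) (σ a).time) := by
  have : (fun a => f (σ a).time ((σ a).play δ (y a) (σ a).time)) =
      fun a => ∑ i, if (σ a).time = i then f i ((σ a).play δ (y a) i) else 0 := by
    funext a
    simp
  rw [this]
  exact Finset.measurable_sum _ fun i _ =>
    Measurable.ite (measurable_time hσ (measurableSet_singleton i))
      (measurable_play hσ hy δ i _) measurable_const

omit hy in
lemma measurable_gradEstimate {r : α → ℝ} (hr : Measurable r) :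
    Measurable fun a => (σ a).gradEstimate δ (r a) := by
  have hz := measurable_z hσ
  have hvu := measurable_v_dotProduct_u hσ
  have hv : Measurable fun a => (σ a).v := measurable_pi_lambda _ fun c => measurable_v hσ c
  have hc : Measurable fun a => 1 - 2 * if (σ a).coin = true then (1 : ℝ) else 0 :=
    measurable_const.sub (measurable_const.mul
      (Measurable.ite (measurableSet_coin hσ) measurable_const measurable_const))
  have hd : Measurable fun a => (σ a).derivEstimate δ (r a) := by
    unfold derivEstimate
    exact Measurable.ite (measurableSet_half_le_z hσ) (by fun_prop) (by fun_prop)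
  unfold gradEstimate
  fun_prop

end Measurable

end Seed

variable {δ : ℝ} {y : M.Coord → ℝ}

/-! ### Feasibility of the points played -/

namespace PartitionMatroid

lemma Feasible.add_single (hy : M.Feasible y) {c : M.Coord} {t : ℝ} (h0 : 0 ≤ y c + t)
    (h1 : ∑ c' with M.slot c' = M.slot c, y c' + t ≤ 1) :
    M.Feasible (y + t • Pi.single c 1) := by
  refine ⟨fun c' => ?_, fun s => ?_⟩
  · by_cases h : c' = c
    · subst h
      simpa using h0
    · simpa [h] using hy.1 c'
  · simp only [Pi.add_apply, Pi.smul_apply, smul_eq_mul, Finset.sum_add_distrib, ← Finset.mul_sum]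
    by_cases h : s = M.slot c
    · subst h
      simpa [Pi.single_apply, Finset.sum_ite_eq] using h1
    · have : ∑ c' with M.slot c' = s, (Pi.single c (1 : ℝ) : M.Coord → ℝ) c' = 0 := by
        refine Finset.sum_eq_zero fun c' hc' => ?_
        have : c' ≠ c := fun h' => h (by rw [← (Finset.mem_filter.1 hc').2, h'])
        simp [this]
      rw [this, mul_zero, add_zero]
      exact hy.2 s

lemma feasible_of_mem_fracSet (hy : y ∈ M.fracSet) : M.Feasible y := by
  have hconv : Convex ℝ {y : M.Coord → ℝ | M.Feasible y} := by
    intro a ha b hb s t hs ht hst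
    refine ⟨fun c => add_nonneg (mul_nonneg hs (ha.1 c)) (mul_nonneg ht (hb.1 c)), fun k => ?_⟩
    simp only [Pi.add_apply, Pi.smul_apply, smul_eq_mul, Finset.sum_add_distrib, ← Finset.mul_sum]
    have h1 := mul_le_mul_of_nonneg_left (ha.2 k) hs
    have h2 := mul_le_mul_of_nonneg_left (hb.2 k) ht
    linarith
  refine convexHull_min ?_ hconv hy
  rintro _ ⟨A, hA, rfl⟩
  refine ⟨fun c => ?_, fun s => ?_⟩
  · unfold indVec
    split_ifs <;> simp
  · have h : ∑ c with M.slot c = s, indVec A c = ((A.filter fun c => M.slot c = s).card : ℝ) := by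
      simp only [indVec, Finset.sum_ite_mem, Finset.sum_const, nsmul_eq_mul, mul_one]
      congr 2
      ext c
      simp [and_comm]
    rw [h]
    exact_mod_cast hA s

lemma card_slot_le (s : M.Slot) :
    (Finset.univ.filter fun c => M.slot c = s).card ≤ M.partCard s.1 := by
  refine Finset.card_le_card_of_injOn Sigma.fst ?_ ?_
  · intro c hc
    obtain rfl := (Finset.mem_filter.1 hc).2
    exact Finset.mem_filter.2 ⟨Finset.mem_univ _, rfl⟩
  · intro c hc c' hc' h
    exact eq_of_slot_eq ((Finset.mem_filter.1 hc).2.trans (Finset.mem_filter.1 hc').2.symm) h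

lemma one_le_partCard (c : M.Coord) : 1 ≤ M.partCard (M.part c.1) :=
  Finset.card_pos.2 ⟨c.1, by simp⟩

lemma two_mul_le_one (hδ : 0 < δ) (hδV : ∀ i, δ * (2 * M.partCard i) ≤ 1) (c : M.Coord) :
    2 * δ ≤ 1 := by
  have h1 : (1 : ℝ) ≤ M.partCard (M.part c.1) := by exact_mod_cast one_le_partCard c
  have h2 := hδV (M.part c.1)
  nlinarith

section Shrunk

variable (hδV : ∀ i, δ * (2 * M.partCard i) ≤ 1) (hy : y ∈ M.shrunkSet δ)
include hδV hy

lemma le_of_mem_shrunkSet (c : M.Coord) : δ ≤ y c := by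
  obtain ⟨x, hx, rfl⟩ := hy
  have h1 := (feasible_of_mem_fracSet hx).1 c
  have h2 : 0 ≤ 1 - 2 * δ * M.partCard (M.part c.1) := by linarith [hδV (M.part c.1)]
  have := mul_nonneg h2 h1
  simp only
  linarith

variable (hδ : 0 < δ)
include hδ

/-- Shrinking frees `2δ|V_i|` and the shift uses up at most `δ|V_i|`. The remaining margin, at least
`δ` in a nonempty slot, leaves room for an upward perturbation; `le_of_mem_shrunkSet` leaves it for
a downward one. -/
lemma sum_slot_le_of_mem_shrunkSet (s : M.Slot) :
    ∑ c with M.slot c = s, y c ≤ 1 - δ * M.partCard s.1 := by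
  obtain ⟨x, hx, rfl⟩ := hy
  have h1 := (feasible_of_mem_fracSet hx).2 s
  have h2 : 0 ≤ 1 - 2 * δ * M.partCard s.1 := by linarith [hδV s.1]
  have h3 : ∑ c with M.slot c = s, ((1 - 2 * δ * M.partCard (M.part c.1)) * x c + δ) =
      (1 - 2 * δ * M.partCard s.1) * ∑ c with M.slot c = s, x c +
        (Finset.univ.filter fun c => M.slot c = s).card * δ := by
    rw [Finset.sum_add_distrib, Finset.mul_sum, Finset.sum_const, nsmul_eq_mul]
    congr 1
    refine Finset.sum_congr rfl fun c hc => ?_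
    obtain rfl := (Finset.mem_filter.1 hc).2
    rfl
  have h4 : ((Finset.univ.filter fun c => M.slot c = s).card : ℝ) ≤ M.partCard s.1 := by
    exact_mod_cast card_slot_le s
  have h5 := mul_le_mul_of_nonneg_left h1 h2
  have h6 := mul_le_mul_of_nonneg_right h4 hδ.le
  rw [h3]
  linarith

lemma feasible_of_mem_shrunkSet : M.Feasible y := by
  refine ⟨fun c => hδ.le.trans (le_of_mem_shrunkSet hδV hy c), fun s => ?_⟩
  refine (sum_slot_le_of_mem_shrunkSet hδV hy hδ s).trans ?_
  have : 0 ≤ δ * M.partCard s.1 := by positivity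
  linarith

end Shrunk

end PartitionMatroid

open PartitionMatroid

namespace Seed

lemma u_eq (ω : Seed M W) : ω.u = 0 ∨ ω.u = Pi.single ω.2.2.2.2.1 1 := by
  unfold u
  split_ifs
  exacts [Or.inl rfl, Or.inr rfl]

lemma abs_v_le (ω : Seed M W) (c : M.Coord) : |ω.v c| ≤ 1 := abs_sphere_apply_le _ c

lemma abs_v_dotProduct_u_le (ω : Seed M W) : |ω.v ⬝ᵥ ω.u| ≤ 1 := by
  rcases ω.u_eq with h | h
  · simp [h]
  · simpa [h] using ω.abs_v_le _

lemma feasible_explorePoint (hδ : 0 < δ) (hδV : ∀ i, δ * (2 * M.partCard i) ≤ 1)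
    (hy : y ∈ M.shrunkSet δ) {ω : Seed M W} (hz : ω.z ∈ Set.Icc (0 : ℝ) 1) :
    M.Feasible (ω.explorePoint δ y) := by
  have hF := feasible_of_mem_shrunkSet hδV hy hδ
  unfold explorePoint
  split_ifs with h1 h2
  · refine Feasible.smul ?_ hz.1 hz.2
    rcases ω.u_eq with h | h
    · simpa [h] using hF
    · rw [h, dotProduct_single_one]
      have hv := abs_le.1 (ω.abs_v_le ω.2.2.2.2.1)
      have h3 := le_of_mem_shrunkSet hδV hy ω.2.2.2.2.1
      have h4 := sum_slot_le_of_mem_shrunkSet hδV hy hδ (M.slot ω.2.2.2.2.1)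
      have h5 : (1 : ℝ) ≤ M.partCard (M.slot ω.2.2.2.2.1).1 := by
        exact_mod_cast one_le_partCard ω.2.2.2.2.1
      refine hF.add_single ?_ ?_
      · nlinarith
      · nlinarith
  · exact hF.smul hz.1 hz.2
  -- Here `z < 1/2`, so each slot sum of `z • y` is below `1/2` and a step of `1/2` fits.
  · have hzy := hF.smul hz.1 hz.2
    have hu : ω.u = Pi.single ω.2.2.2.2.1 1 := if_neg fun h => h1 h.1
    rw [hu]
    refine hzy.add_single (by linarith [hzy.1 ω.2.2.2.2.1]) ?_
    simp only [Pi.smul_apply, smul_eq_mul, ← Finset.mul_sum]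
    have h3 := mul_le_mul_of_nonneg_left (hF.2 (M.slot ω.2.2.2.2.1)) hz.1
    linarith

lemma play_mem_decisions (hδ : 0 < δ) (hδV : ∀ i, δ * (2 * M.partCard i) ≤ 1)
    (hy : y ∈ M.shrunkSet δ) {ω : Seed M W} (hz : ω.z ∈ Set.Icc (0 : ℝ) 1) (i : Fin W) :
    ω.play δ y i ∈ M.decisions := by
  unfold play
  split_ifs
  · exact merge_mem_decisions (round_mem_lifted (feasible_explorePoint hδ hδV hy hz).1 _)
  · exact merge_mem_decisions (round_mem_lifted (feasible_of_mem_shrunkSet hδV hy hδ).1 _)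

/-! ### The gradient estimate is bounded and unbiased -/

lemma derivEstimate_eq_mul (ω : Seed M W) (r : ℝ) :
    ω.derivEstimate δ r = ω.derivEstimate δ 1 * r := by
  unfold derivEstimate
  split_ifs <;> ring

/-- The branch `z ≥ 1/2` keeps `2/z ≤ 4`; for smaller `z` no division occurs, and the factor `δ⟨v,
u⟩` is at most one in absolute value. -/
lemma abs_derivEstimate_le (hδ : 0 < δ) (hδ1 : δ ≤ 1) (ω : Seed M W) {r C : ℝ} (hr : 0 ≤ r)
    (hrC : r ≤ C) : |ω.derivEstimate δ r| ≤ 4 * ratio * M.dim * C := by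
  have hα := ratio_pos
  have hC : 0 ≤ C := hr.trans hrC
  have hs : |1 - 2 * if ω.coin = true then (1 : ℝ) else 0| = 1 := by
    split_ifs <;> norm_num
  unfold derivEstimate
  generalize (1 - 2 * if ω.coin = true then (1 : ℝ) else 0) = b at hs ⊢
  have h4 : 0 ≤ 4 * ratio * M.dim := by positivity
  split_ifs with h
  · have hz : 0 < ω.z := by linarith
    rw [abs_mul, hs, mul_one, abs_of_nonneg (by positivity)]
    refine mul_le_mul ?_ hrC hr h4
    have : (M.dim : ℝ) / ω.z ≤ 2 * M.dim := by
      rw [div_le_iff₀ hz]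
      nlinarith [Nat.cast_nonneg (α := ℝ) M.dim]
    nlinarith
  · rw [abs_mul, hs, mul_one, abs_mul, abs_mul, abs_of_nonneg h4, abs_of_nonneg hr, abs_mul,
      abs_of_pos hδ]
    refine mul_le_mul (mul_le_of_le_one_right h4 ?_) hrC hr h4
    exact mul_le_one₀ hδ1 (abs_nonneg _) ω.abs_v_dotProduct_u_le

lemma norm_gradEstimate_le (hδ : 0 < δ) (hδ1 : δ ≤ 1) (ω : Seed M W) {r C : ℝ} (hr : 0 ≤ r)
    (hrC : r ≤ C) :
    ‖WithLp.toLp 2 (ω.gradEstimate δ r)‖ ≤ 4 * ratio * M.dim ^ 2 * C / δ := by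
  have hv : ‖WithLp.toLp 2 ω.v‖ = 1 := by
    have : WithLp.toLp 2 ω.v = ω.2.2.1.1 := rfl
    rw [this]
    simp
  rw [gradEstimate, WithLp.toLp_smul, WithLp.toLp_smul, norm_smul, norm_smul, hv, mul_one,
    Real.norm_eq_abs, Real.norm_eq_abs, abs_mul, abs_of_pos (inv_pos.2 hδ), ← div_eq_mul_inv,
    Nat.abs_cast]
  have := mul_le_mul_of_nonneg_left (ω.abs_derivEstimate_le hδ hδ1 hr hrC)
    (Nat.cast_nonneg (α := ℝ) M.dim)
  refine div_le_div_of_nonneg_right (this.trans_eq ?_) hδ.le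
  ring

lemma abs_dotProduct_gradEstimate_le (hδ : 0 < δ) (hδ1 : δ ≤ 1) (ω : Seed M W) {r C : ℝ}
    (hr : 0 ≤ r) (hrC : r ≤ C) (d : M.Coord → ℝ) :
    |d ⬝ᵥ ω.gradEstimate δ r| ≤ ‖WithLp.toLp 2 d‖ * (4 * ratio * M.dim ^ 2 * C / δ) := by
  have h := abs_real_inner_le_norm (WithLp.toLp 2 (ω.gradEstimate δ r)) (WithLp.toLp 2 d)
  rw [EuclideanSpace.inner_toLp_toLp, star_trivial, mul_comm] at h
  exact h.trans (mul_le_mul_of_nonneg_left (ω.norm_gradEstimate_le hδ hδ1 hr hrC) (norm_nonneg _))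

/-- The coin forms the difference of F at `z • y + t • e_c` and at `z • y`, which is exactly `t ∂_c
F(zy)`. The step `t` is `zδv_c` with weight `2αn'/z`, or `1/2` with weight `4αn'δv_c`; after
averaging, both give `αδ v_c ∂_c F`. -/
lemma average_derivEstimate [Nonempty M.Coord] (f : Finset (Fin n) → ℝ) (δ : ℝ)
    (y : M.Coord → ℝ) (i : Fin W) {z : ℝ}
    (v : Metric.sphere (0 : EuclideanSpace ℝ M.Coord) 1) (U : Fin W → M.Slot → ℝ) :
    (2 : ℝ)⁻¹ * ∑ b, (M.dim : ℝ)⁻¹ * ∑ c, derivEstimate (M := M) (i, z, v, b, c, U) δ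
        (M.extension f (explorePoint (M := M) (i, z, v, b, c, U) δ y)) =
      ratio * δ * ∑ c, v.1 c * M.extensionGrad f (z • y) c := by
  have hdim : (M.dim : ℝ) ≠ 0 := by
    have : 0 < M.dim := Fintype.card_pos
    positivity
  rw [Fintype.sum_bool, ← mul_add, ← Finset.sum_add_distrib, Finset.mul_sum, Finset.mul_sum,
    Finset.mul_sum]
  refine Finset.sum_congr rfl fun c _ => ?_
  have hvc : ∀ b, Seed.v (M := M) (i, z, v, b, c, U) ⬝ᵥ Pi.single c 1 = v.1 c := fun b =>
    dotProduct_single_one _ _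
  by_cases h : 1 / 2 ≤ z
  · have hz : z ≠ 0 := by linarith
    have h1 : z • (y + (δ * v.1 c) • (Pi.single c 1 : M.Coord → ℝ)) =
        z • y + (z * (δ * v.1 c)) • Pi.single c 1 := by
      rw [smul_add, smul_smul]
    simp only [derivEstimate, explorePoint, u, Seed.z, coin, basisVec, h, if_true, and_true,
      smul_zero, add_zero, Bool.false_eq_true, and_false, if_false, hvc, h1,
      extension_add_single]
    field_simp
    ring
  · simp only [derivEstimate, explorePoint, u, Seed.z, coin, basisVec, h, if_true,
      Bool.false_eq_true, false_and, if_false, hvc, extension_add_single]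
    field_simp
    ring

end Seed

/-! ### One window -/

lemma dotProduct_gradEstimate (ω : Seed M W) (δ r : ℝ) (d : M.Coord → ℝ) :
    d ⬝ᵥ ω.gradEstimate δ r = (M.dim * δ⁻¹ * ∑ c, d c * ω.v c) * ω.derivEstimate δ r := by
  rw [Seed.gradEstimate, dotProduct_smul, dotProduct_smul, smul_eq_mul, smul_eq_mul]
  simp only [dotProduct]
  ring

lemma integral_round_eval (hy : M.Feasible y) (f : Finset (Fin n) → ℝ) (i : Fin W) :
    ∫ U, f (M.merge (M.round y (U i))) ∂(Measure.pi fun _ : Fin W => Measure.pi fun _ : M.Slot =>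
      volume.restrict (Set.Icc (0 : ℝ) 1)) = M.extension f y := by
  rw [← hy.integral_round]
  have hmeas : Measurable fun U : M.Slot → ℝ => f (M.merge (M.round y U)) :=
    measurable_round measurable_const measurable_id fun A => f (M.merge A)
  exact integral_comp_eval (X := fun _ : Fin W => M.Slot → ℝ) hmeas.aestronglyMeasurable

section Window

variable [Nonempty M.Coord] (hδ : 0 < δ) (hδV : ∀ i, δ * (2 * M.partCard i) ≤ 1)
  (hy : y ∈ M.shrunkSet δ) {f : Fin W → Finset (Fin n) → ℝ} (hm : ∀ i, Monotone (f i))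
  (h0 : ∀ i S, 0 ≤ f i S)

-- A crude bound valid for all sets, hence for all seeds; `L` bounds the reward on independent sets
-- only. It serves integrability.
omit [Nonempty M.Coord] in
include hm h0 in
lemma reward_le_sum (i : Fin W) (S : Finset (Fin n)) : f i S ≤ ∑ j, f j Finset.univ :=
  (hm i (Finset.subset_univ S)).trans
    (Finset.single_le_sum (f := fun j => f j Finset.univ) (fun j _ => h0 j _) (Finset.mem_univ i))

include hδ hδV hm h0 in
lemma abs_dotProduct_gradEstimate_reward_le (ω : Seed M W) (y d : M.Coord → ℝ) :
    |d ⬝ᵥ ω.gradEstimate δ (f ω.time (ω.play δ y ω.time))| ≤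
      ‖WithLp.toLp 2 d‖ * (4 * ratio * M.dim ^ 2 * (∑ j, f j Finset.univ) / δ) := by
  have := two_mul_le_one hδ hδV (Classical.arbitrary M.Coord)
  exact ω.abs_dotProduct_gradEstimate_le hδ (by linarith) (h0 _ _) (reward_le_sum hm h0 _ _) d

variable [Nonempty (Fin W)]

include hδ hδV hy hm h0

/-- The gradient estimate is unbiased for the gradient of the boosted objective. -/
lemma integral_dotProduct_gradEstimate (d : M.Coord → ℝ) :
    ∫ ω, d ⬝ᵥ ω.gradEstimate δ (f ω.time (ω.play δ y ω.time)) ∂seedLaw M W =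
      (W : ℝ)⁻¹ * ∑ i, ∫ z in (0 : ℝ)..1,
        Real.exp (z - 1) * ∑ c, d c * M.extensionGrad (f i) (z • y) c := by
  have hmeas : Measurable fun ω : Seed M W =>
      d ⬝ᵥ ω.gradEstimate δ (f ω.time (ω.play δ y ω.time)) := by
    have h1 := Seed.measurable_gradEstimate (σ := fun ω : Seed M W => ω) measurable_id δ
      (Seed.measurable_reward (y := fun _ => y) measurable_id measurable_const δ f)
    exact Finset.measurable_sum _ fun c _ =>
      measurable_const.mul ((measurable_pi_apply c).comp h1)
  rw [integral_seedLaw hmeas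
    (abs_dotProduct_gradEstimate_reward_le hδ hδV hm h0 · y d)]
  congr 1
  refine Finset.sum_congr rfl fun i _ => ?_
  rw [integral_scaleLaw]
  refine intervalIntegral.integral_congr fun z hz => ?_
  rw [Set.uIcc_of_le zero_le_one] at hz
  have hdim : (M.dim : ℝ) ≠ 0 := by
    have : 0 < M.dim := Fintype.card_pos
    positivity
  have hv : ∀ v : Metric.sphere (0 : EuclideanSpace ℝ M.Coord) 1,
      (2 : ℝ)⁻¹ * ∑ b, (M.dim : ℝ)⁻¹ * ∑ c, ∫ U : Fin W → M.Slot → ℝ,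
        d ⬝ᵥ Seed.gradEstimate (M := M) (i, z, v, b, c, U) δ
          (f i (Seed.play (M := M) (i, z, v, b, c, U) δ y i))
        ∂(Measure.pi fun _ : Fin W => Measure.pi fun _ : M.Slot =>
          volume.restrict (Set.Icc (0 : ℝ) 1)) =
      (M.dim * ratio) * ((∑ c, d c * v.1 c) *
        ∑ c, v.1 c * M.extensionGrad (f i) (z • y) c) := by
    intro v
    -- The rounding enters only through the reward, in which the estimate is linear, so integrating
    -- `U` replaces the reward by the extension. The zero `U` on the right is a dummy.
    have h1 : ∀ b c, ∫ U : Fin W → M.Slot → ℝ,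
        d ⬝ᵥ Seed.gradEstimate (M := M) (i, z, v, b, c, U) δ
          (f i (Seed.play (M := M) (i, z, v, b, c, U) δ y i))
        ∂(Measure.pi fun _ : Fin W => Measure.pi fun _ : M.Slot =>
          volume.restrict (Set.Icc (0 : ℝ) 1)) =
        (M.dim * δ⁻¹ * ∑ c, d c * v.1 c) *
          Seed.derivEstimate (M := M) (i, z, v, b, c, (fun _ _ => 0 : Fin W → M.Slot → ℝ)) δ
            (M.extension (f i) (Seed.explorePoint (M := M)
              (i, z, v, b, c, (fun _ _ => 0 : Fin W → M.Slot → ℝ)) δ y)) := by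
      intro b c
      rw [Seed.derivEstimate_eq_mul, ← integral_round_eval (W := W) (i := i)
        (Seed.feasible_explorePoint (ω := ((i, z, v, b, c, fun _ _ => 0) : Seed M W)) hδ hδV hy hz),
        ← mul_assoc, ← integral_const_mul]
      refine integral_congr_ae (Filter.Eventually.of_forall fun U => ?_)
      simp only [dotProduct_gradEstimate]
      rw [Seed.derivEstimate_eq_mul, ← mul_assoc]
      have h2 : Seed.play (M := M) (i, z, v, b, c, U) δ y i =
          M.merge (M.round (Seed.explorePoint (M := M) (i, z, v, b, c, U) δ y) (U i)) :=
        if_pos rfl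
      rw [h2]
      rfl
    simp only [h1]
    have h3 := Seed.average_derivEstimate (f i) δ y i (z := z) v (fun _ _ => 0)
    simp only [← Finset.mul_sum] at h3 ⊢
    rw [mul_left_comm ((M.dim : ℝ)⁻¹), mul_left_comm, h3]
    field_simp
  have hv' : ∫ v : Metric.sphere (0 : EuclideanSpace ℝ M.Coord) 1,
      (2 : ℝ)⁻¹ * ∑ b, (M.dim : ℝ)⁻¹ * ∑ c, ∫ U : Fin W → M.Slot → ℝ,
        d ⬝ᵥ Seed.gradEstimate (M := M) (i, z, v, b, c, U) δ
          (f i (Seed.play (M := M) (i, z, v, b, c, U) δ y i))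
        ∂(Measure.pi fun _ : Fin W => Measure.pi fun _ : M.Slot =>
          volume.restrict (Set.Icc (0 : ℝ) 1)) ∂sphereLaw M.Coord =
      ratio * ∑ c, d c * M.extensionGrad (f i) (z • y) c := by
    simp only [hv]
    rw [integral_const_mul, integral_sphere_dotProduct_mul]
    change (M.dim : ℝ) * ratio * ((M.dim : ℝ)⁻¹ * _) = _
    field_simp
  have hα := ratio_pos.ne'
  refine (congrArg (Real.exp (z - 1) / ratio * ·) hv').trans ?_
  field_simp

/-- The nonnegative reward of the exploration time is discarded. A given time is explored with
probability `1/W` and otherwise receives a plain rounding of `y`. -/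
lemma le_integral_sum_play :
    (1 - (W : ℝ)⁻¹) * ∑ i, M.extension (f i) y ≤
      ∫ ω, ∑ i, f i (ω.play δ y i) ∂seedLaw M W := by
  have hF := feasible_of_mem_shrunkSet hδV hy hδ
  have hsum : ∀ S : Fin W → Finset (Fin n), |∑ i, f i (S i)| ≤ ∑ i, f i Finset.univ := by
    intro S
    rw [abs_of_nonneg (Finset.sum_nonneg fun i _ => h0 i _)]
    exact Finset.sum_le_sum fun i _ => hm i (Finset.subset_univ _)
  have hmeas1 : Measurable fun ω : Seed M W => ∑ i, f i (ω.play δ y i) :=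
    Finset.measurable_sum _ fun i _ =>
      Seed.measurable_play (σ := fun ω : Seed M W => ω) (y := fun _ => y) measurable_id
        measurable_const δ i (f i)
  have hmeas2 : Measurable fun ω : Seed M W =>
      ∑ i, if ω.time = i then 0 else f i (M.merge (M.round y (ω.U i))) :=
    Finset.measurable_sum _ fun i _ => Measurable.ite
      (Seed.measurable_time (σ := fun ω : Seed M W => ω) measurable_id (measurableSet_singleton i))
      measurable_const (measurable_round measurable_const
        (Seed.measurable_U (σ := fun ω : Seed M W => ω) measurable_id i) fun A => f i (M.merge A))
  have hbound2 : ∀ ω : Seed M W,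
      |∑ i, if ω.time = i then 0 else f i (M.merge (M.round y (ω.U i)))| ≤
        ∑ i, f i Finset.univ := by
    intro ω
    rw [abs_of_nonneg (Finset.sum_nonneg fun i _ => by split_ifs; exacts [le_rfl, h0 i _])]
    refine Finset.sum_le_sum fun i _ => ?_
    split_ifs
    exacts [h0 i _, hm i (Finset.subset_univ _)]
  have hint : ∫ ω : Seed M W, (∑ i, if ω.time = i then 0 else f i (M.merge (M.round y (ω.U i))))
      ∂seedLaw M W = (1 - (W : ℝ)⁻¹) * ∑ i, M.extension (f i) y := by
    have hW : (W : ℝ) ≠ 0 := by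
      have : 0 < W := Fin.pos (Classical.arbitrary (Fin W))
      positivity
    have hdim : (M.dim : ℝ) ≠ 0 := by
      have : 0 < M.dim := Fintype.card_pos
      positivity
    have h1 : ∀ (i : Fin W) (z : ℝ) (v : Metric.sphere (0 : EuclideanSpace ℝ M.Coord) 1) (b : Bool)
        (c : M.Coord), ∫ U : Fin W → M.Slot → ℝ,
          (∑ j, if Seed.time (M := M) (i, z, v, b, c, U) = j then 0 else
            f j (M.merge (M.round y (Seed.U (M := M) (i, z, v, b, c, U) j))))
          ∂(Measure.pi fun _ : Fin W => Measure.pi fun _ : M.Slot =>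
            volume.restrict (Set.Icc (0 : ℝ) 1)) =
        (∑ j, M.extension (f j) y) - M.extension (f i) y := by
      intro i z v b c
      rw [integral_finsetSum]
      · have h2 : ∀ j, (∫ U : Fin W → M.Slot → ℝ,
            (if Seed.time (M := M) (i, z, v, b, c, U) = j then 0 else
              f j (M.merge (M.round y (Seed.U (M := M) (i, z, v, b, c, U) j))))
            ∂(Measure.pi fun _ : Fin W => Measure.pi fun _ : M.Slot =>
              volume.restrict (Set.Icc (0 : ℝ) 1))) =
            M.extension (f j) y - if i = j then M.extension (f j) y else 0 := by
          intro j
          by_cases hij : i = j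
          · simp [Seed.time, hij]
          · simp only [Seed.time, Seed.U, hij, if_false, sub_zero]
            exact integral_round_eval hF (f j) j
        rw [Finset.sum_congr rfl fun j _ => h2 j, Finset.sum_sub_distrib]
        simp
      · intro j _
        refine Integrable.of_bound (Measurable.aestronglyMeasurable ?_) (f j Finset.univ)
          (Filter.Eventually.of_forall fun U => ?_)
        · exact Measurable.ite
            (show MeasurableSet {_U : Fin W → M.Slot → ℝ | i = j} from MeasurableSet.const _)
            measurable_const
            (measurable_round measurable_const (measurable_pi_apply j) fun A => f j (M.merge A))
        · rw [Real.norm_eq_abs]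
          split_ifs
          · simpa using h0 j _
          · rw [abs_of_nonneg (h0 j _)]
            exact hm j (Finset.subset_univ _)
    rw [integral_seedLaw hmeas2 hbound2]
    simp only [h1, integral_const, probReal_univ, one_smul, Finset.sum_const, Finset.card_univ,
      Fintype.card_bool, nsmul_eq_mul]
    change (W : ℝ)⁻¹ * ∑ i : Fin W, 2⁻¹ * (((2 : ℕ) : ℝ) * ((M.dim : ℝ)⁻¹ * ((M.dim : ℝ) *
      ((∑ j, M.extension (f j) y) - M.extension (f i) y)))) = _
    have h4 : ∀ a : ℝ, 2⁻¹ * (((2 : ℕ) : ℝ) * ((M.dim : ℝ)⁻¹ * ((M.dim : ℝ) * a))) = a := by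
      intro a
      push_cast
      field_simp
    simp only [h4, Finset.sum_sub_distrib, Finset.sum_const, Finset.card_univ, Fintype.card_fin,
      nsmul_eq_mul]
    field_simp
  rw [← hint]
  refine integral_mono
    (Integrable.of_bound hmeas2.aestronglyMeasurable _ (Filter.Eventually.of_forall hbound2))
    (Integrable.of_bound hmeas1.aestronglyMeasurable _
      (Filter.Eventually.of_forall fun ω => hsum _)) fun ω => ?_
  refine Finset.sum_le_sum fun i _ => ?_
  split_ifs with h
  · exact h0 i _
  · have : ω.play δ y i = M.merge (M.round y (ω.U i)) := if_neg fun h' => h h'.symm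
    rw [this]

end Window

namespace PartitionMatroid

lemma chosen_mem_lifted (φ : M.Slot → Option M.Coord) : M.chosen φ ∈ M.lifted := by
  intro s
  rw [Finset.card_le_one]
  simp only [chosen, Finset.mem_filter, Finset.mem_univ, true_and]
  rintro a ⟨ha, rfl⟩ b ⟨hb, h⟩
  rw [h] at hb
  exact Option.some_inj.1 (ha.symm.trans hb)

lemma Feasible.extension_le (hy : M.Feasible y) {f : Finset (Fin n) → ℝ} {L : ℝ}
    (hL : ∀ S ∈ M.decisions, f S ≤ L) : M.extension f y ≤ L := by
  rw [← prodExp_const (fun s => sum_slotWeight y s) L]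
  exact prodExp_mono hy.slotWeight_nonneg fun φ => hL _ (merge_mem_decisions (chosen_mem_lifted φ))

lemma card_le_rank {S : Finset (Fin n)} (hS : S ∈ M.decisions) : S.card ≤ M.rank := by
  refine le_csSup ⟨n, ?_⟩ ⟨S, hS, rfl⟩
  rintro _ ⟨S', -, rfl⟩
  simpa using Finset.card_le_univ S'

lemma partCard_le (i : Fin m) : M.partCard i ≤ n := by
  unfold partCard
  simpa using Finset.card_le_univ (Finset.univ.filter fun k => M.part k = i)

/-- Shrinking the decision set changes the value by at most a multiple of `δ`. -/
lemma sub_extension_shrink_le (hrank : 0 < M.rank) (hδ : 0 < δ)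
    (hδV : ∀ i, δ * (2 * M.partCard i) ≤ 1) {L : ℝ} {f : Finset (Fin n) → ℝ}
    (hf : f ∈ M.rewards L) {A : Finset M.Coord} (hA : A ∈ M.lifted)
    (hinj : Set.InjOn Sigma.fst (A : Set M.Coord)) :
    f (M.merge A) - M.extension f (M.shrink δ (indVec A)) ≤ 2 * δ * M.rank ^ 2 * n * L := by
  obtain ⟨hm, -, h0, hfL⟩ := hf
  have hF := feasible_of_mem_shrunkSet hδV (shrink_indVec_mem hA) hδ
  have h1 := hF.le_extension hm h0 A
  have hS := merge_mem_decisions hA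
  have hcard : A.card ≤ M.rank := by
    rw [← Finset.card_image_of_injOn hinj]
    exact card_le_rank hS
  have h2 : ∑ c ∈ A, (1 - M.shrink δ (indVec A) c) ≤ A.card * (2 * δ * n) := by
    rw [← nsmul_eq_mul]
    refine Finset.sum_le_card_nsmul _ _ _ fun c hc => ?_
    have h3 : (M.partCard (M.part c.1) : ℝ) ≤ n := by exact_mod_cast partCard_le _
    simp only [shrink, indVec, hc, if_true, mul_one]
    nlinarith
  have hr : (1 : ℝ) ≤ M.rank := by exact_mod_cast hrank
  have hcard' : (A.card : ℝ) ≤ M.rank := by exact_mod_cast hcard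
  -- The union bound needs only one factor of the rank; the square is slack, by `1 ≤ M.rank`.
  have h4 : (A.card : ℝ) * (2 * δ * n) ≤ M.rank ^ 2 * (2 * δ * n) := by
    refine mul_le_mul_of_nonneg_right ?_ (by positivity)
    nlinarith
  have h5 : f (M.merge A) * ∑ c ∈ A, (1 - M.shrink δ (indVec A) c) ≤
      L * (M.rank ^ 2 * (2 * δ * n)) :=
    (mul_le_mul_of_nonneg_left (h2.trans h4) (h0 _)).trans
      (mul_le_mul_of_nonneg_right (hfL _ hS) (by positivity))
  linarith

end PartitionMatroid

/-- The regret in one window, against a decision whose lift is `A`. -/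
lemma window_regret_le (hrank : 0 < M.rank) [Nonempty M.Coord] [Nonempty (Fin W)] (hδ : 0 < δ)
    (hδV : ∀ i, δ * (2 * M.partCard i) ≤ 1) (hy : y ∈ M.shrunkSet δ) {L : ℝ}
    {f : Fin W → Finset (Fin n) → ℝ} (hf : ∀ i, f i ∈ M.rewards L) {A : Finset M.Coord}
    (hA : A ∈ M.lifted) (hinj : Set.InjOn Sigma.fst (A : Set M.Coord)) :
    ratio * ∑ i, f i (M.merge A) ≤ ∫ ω, ∑ i, f i (ω.play δ y i) ∂seedLaw M W +
      W * ∫ ω, (M.shrink δ (indVec A) - y) ⬝ᵥ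
        ω.gradEstimate δ (f ω.time (ω.play δ y ω.time)) ∂seedLaw M W +
      (L + W * (2 * ratio * δ * M.rank ^ 2 * n * L)) := by
  have hF := feasible_of_mem_shrunkSet hδV hy hδ
  have hFA := feasible_of_mem_shrunkSet hδV (shrink_indVec_mem hA) hδ
  have hm : ∀ i, Monotone (f i) := fun i => (hf i).1
  have h0 : ∀ i S, 0 ≤ f i S := fun i => (hf i).2.2.1
  have hW : (0 : ℝ) < W := by
    have : 0 < W := Fin.pos (Classical.arbitrary (Fin W))
    positivity
  have h1 := le_integral_sum_play hδ hδV hy hm h0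
  rw [integral_dotProduct_gradEstimate hδ hδV hy hm h0, mul_inv_cancel_left₀ hW.ne']
  have h2 : ∀ i, ratio * f i (M.merge A) ≤ M.extension (f i) y + (∫ z in (0 : ℝ)..1,
      Real.exp (z - 1) * ∑ c, (M.shrink δ (indVec A) - y) c *
        M.extensionGrad (f i) (z • y) c) + 2 * ratio * δ * M.rank ^ 2 * n * L := by
    intro i
    have h3 := hFA.ratio_mul_extension_sub_le (hm i) (hf i).2.1 (h0 i) hF
    have h4 := mul_le_mul_of_nonneg_left
      (sub_extension_shrink_le hrank hδ hδV (hf i) hA hinj) ratio_pos.le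
    simp only [Pi.sub_apply]
    linarith
  have h5 := Finset.sum_le_sum fun i (_ : i ∈ Finset.univ) => h2 i
  rw [← Finset.mul_sum, Finset.sum_add_distrib, Finset.sum_add_distrib, Finset.sum_const,
    Finset.card_univ, Fintype.card_fin, nsmul_eq_mul] at h5
  -- The lost exploration time costs the average of the extensions over the window.
  have h6 : (W : ℝ)⁻¹ * ∑ i, M.extension (f i) y ≤ L := by
    rw [inv_mul_le_iff₀ hW]
    refine (Finset.sum_le_card_nsmul _ _ L fun i _ => hF.extension_le (hf i).2.2.2).trans_eq ?_
    simp
  linarith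

/-! ### Integrating out one window -/

/-- Resampling one of several i.i.d. coordinates does not change their joint law. This isolates one
seed without splitting the product. -/
lemma measurePreserving_update {ι X : Type*} [Fintype ι] [DecidableEq ι] [MeasurableSpace X]
    (ν : Measure X) [IsProbabilityMeasure ν] (i : ι) :
    MeasurePreserving (fun x : (ι → X) × X => Function.update x.1 i x.2)
      ((Measure.pi fun _ => ν).prod ν) (Measure.pi fun _ => ν) := by
  have hm : Measurable fun x : (ι → X) × X => Function.update x.1 i x.2 := by
    refine measurable_pi_lambda _ fun j => ?_
    by_cases h : j = i
    · subst h
      simpa using measurable_snd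
    · simp only [Function.update_of_ne h]
      exact (measurable_pi_apply j).comp measurable_fst
  refine ⟨hm, (Measure.pi_eq fun s hs => ?_).symm⟩
  rw [Measure.map_apply hm (MeasurableSet.univ_pi hs)]
  have h1 : (fun x : (ι → X) × X => Function.update x.1 i x.2) ⁻¹' Set.univ.pi s =
      (Set.univ.pi (Function.update s i Set.univ)) ×ˢ s i := by
    ext ⟨x, a⟩
    simp only [Set.mem_preimage, Set.mem_univ_pi, Set.mem_prod]
    constructor
    · intro h
      refine ⟨fun j => ?_, by simpa using h i⟩
      by_cases hj : j = i
      · subst hj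
        simp
      · simpa [hj] using h j
    · rintro ⟨h, ha⟩ j
      by_cases hj : j = i
      · subst hj
        simpa using ha
      · simpa [hj] using h j
  rw [h1, Measure.prod_prod, Measure.pi_pi, ← Finset.mul_prod_erase _ _ (Finset.mem_univ i),
    ← Finset.mul_prod_erase _ (fun j => ν (s j)) (Finset.mem_univ i), Function.update_self,
    measure_univ, one_mul, mul_comm]
  congr 1
  refine Finset.prod_congr rfl fun j hj => ?_
  rw [Function.update_of_ne (Finset.ne_of_mem_erase hj)]

lemma integrable_update {ι X : Type*} [Fintype ι] [DecidableEq ι] [MeasurableSpace X]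
    {ν : Measure X} [IsProbabilityMeasure ν] (i : ι) {g : (ι → X) → ℝ}
    (hg : Integrable g (Measure.pi fun _ => ν)) :
    Integrable (fun ω => ∫ a, g (Function.update ω i a) ∂ν) (Measure.pi fun _ => ν) :=
  ((measurePreserving_update ν i).integrable_comp_of_integrable hg).integral_prod_left

lemma integral_update {ι X : Type*} [Fintype ι] [DecidableEq ι] [MeasurableSpace X]
    {ν : Measure X} [IsProbabilityMeasure ν] (i : ι) {g : (ι → X) → ℝ}
    (hg : Integrable g (Measure.pi fun _ => ν)) :
    ∫ ω, g ω ∂(Measure.pi fun _ => ν) =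
      ∫ ω, ∫ a, g (Function.update ω i a) ∂ν ∂(Measure.pi fun _ => ν) := by
  have h := measurePreserving_update ν i
  rw [← integral_prod (fun x : (ι → X) × X => g (Function.update x.1 i x.2))
    (h.integrable_comp_of_integrable hg), ← integral_map (φ := fun x : (ι → X) × X =>
    Function.update x.1 i x.2) h.measurable.aemeasurable, h.map_eq]
  rw [h.map_eq]
  exact hg.aestronglyMeasurable

/-! ### The decisions of the policy -/

variable {R : Set ((M.Coord → ℝ) → ℝ)} {N : ℕ}

/-- The gradient estimate of the window `l`. -/
def windowGrad (P : OCOPolicy (M.shrunkSet δ) R) (f : ℕ → Finset (Fin n) → ℝ)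
    (ω : Fin N → Seed M W) (l : Fin N) : M.Coord → ℝ :=
  (ω l).gradEstimate δ (f (l * W + (ω l).time)
    ((ω l).play δ (windowDecision P f ω l) (ω l).time))

variable (P : OCOPolicy (M.shrunkSet δ) R) (f : ℕ → Finset (Fin n) → ℝ)

lemma windowDecision_eq (ω : Fin N → Seed M W) (l : Fin N) :
    windowDecision P f ω l = P.act l (fun s => windowDecision P f ω ⟨s, s.2.trans l.2⟩)
      fun s y => y ⬝ᵥ windowGrad P f ω ⟨s, s.2.trans l.2⟩ := by
  rw [windowDecision]
  rfl

lemma measurable_windowGrad_of {l : Fin N}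
    (h : Measurable fun ω : Fin N → Seed M W => windowDecision P f ω l) :
    Measurable fun ω : Fin N → Seed M W => windowGrad P f ω l :=
  Seed.measurable_gradEstimate (measurable_pi_apply l) δ
    (Seed.measurable_reward (measurable_pi_apply l) h δ fun i : Fin W => f (l * W + i))

lemma measurable_windowDecision (l : Fin N) :
    Measurable fun ω : Fin N → Seed M W => windowDecision P f ω l := by
  obtain ⟨l, hl⟩ := l
  induction l using Nat.strong_induction_on with
  | _ l ih =>
    simp only [windowDecision_eq P f _ ⟨l, hl⟩]
    refine (P.measurable_act l).comp (Measurable.prodMk ?_ ?_)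
    · exact measurable_pi_lambda _ fun s => ih s s.2 _
    · exact measurable_pi_lambda _ fun s => measurable_windowGrad_of P f (ih s s.2 _)

lemma measurable_windowGrad (l : Fin N) :
    Measurable fun ω : Fin N → Seed M W => windowGrad P f ω l :=
  measurable_windowGrad_of P f (measurable_windowDecision P f l)

/-- Only seeds of earlier windows matter, so `k = l` is included: resampling the seed of a window
leaves its own decision fixed. -/
lemma windowDecision_update (ω : Fin N → Seed M W) (l : Fin N) (σ : Seed M W) (k : Fin N)
    (hk : k ≤ l) : windowDecision P f (Function.update ω l σ) k = windowDecision P f ω k := by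
  obtain ⟨k, hkN⟩ := k
  induction k using Nat.strong_induction_on with
  | _ k ih =>
    have hlt : ∀ s : Fin k, (⟨s, s.2.trans hkN⟩ : Fin N) < l := fun s =>
      lt_of_lt_of_le (show (s : ℕ) < k from s.2) hk
    have h1 : ∀ s : Fin k, windowDecision P f (Function.update ω l σ) ⟨s, s.2.trans hkN⟩ =
        windowDecision P f ω ⟨s, s.2.trans hkN⟩ := fun s => ih s s.2 _ (hlt s).le
    rw [windowDecision_eq, windowDecision_eq P f ω]
    simp only [windowGrad, h1, Function.update_of_ne (hlt _).ne]

/-! ### Bounds along a sample path -/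

section Bounds

variable {P f} [Nonempty M.Coord] (hδ : 0 < δ) (hδV : ∀ i, δ * (2 * M.partCard i) ≤ 1) {L : ℝ}
  (hf : ∀ t, f t ∈ M.rewards L)
include hδ hδV hf

lemma norm_windowGrad_le {ω : Fin N → Seed M W} {l : Fin N}
    (hz : (ω l).z ∈ Set.Icc (0 : ℝ) 1) (hy : windowDecision P f ω l ∈ M.shrunkSet δ) :
    ‖WithLp.toLp 2 (windowGrad P f ω l)‖ ≤ 4 * ratio * M.dim ^ 2 * L / δ := by
  have := two_mul_le_one hδ hδV (Classical.arbitrary M.Coord)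
  exact Seed.norm_gradEstimate_le hδ (by linarith) _ ((hf _).2.2.1 _)
    ((hf _).2.2.2 _ (Seed.play_mem_decisions hδ hδV hy hz _))

variable (hR : ∀ g : M.Coord → ℝ, ‖WithLp.toLp 2 g‖ ≤ 4 * ratio * M.dim ^ 2 * L / δ →
  (fun y => y ⬝ᵥ g) ∈ R)
include hR

/-- Strong induction: feasible earlier decisions give bounded gradient estimates, hence rewards in
`R`, hence a feasible next decision. -/
lemma windowDecision_mem {ω : Fin N → Seed M W} (hz : ∀ l, (ω l).z ∈ Set.Icc (0 : ℝ) 1)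
    (l : Fin N) : windowDecision P f ω l ∈ M.shrunkSet δ := by
  obtain ⟨l, hl⟩ := l
  induction l using Nat.strong_induction_on with
  | _ l ih =>
    rw [windowDecision_eq]
    exact P.act_mem _ _ _ (fun s => ih s s.2 _) fun s =>
      hR _ (norm_windowGrad_le hδ hδV hf (hz _) (ih s s.2 _))

lemma windowGrad_mem {ω : Fin N → Seed M W} (hz : ∀ l, (ω l).z ∈ Set.Icc (0 : ℝ) 1)
    (l : Fin N) : (fun y => y ⬝ᵥ windowGrad P f ω l) ∈ R :=
  hR _ (norm_windowGrad_le hδ hδV hf (hz l) (windowDecision_mem hδ hδV hf hR hz l))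

/-- On each sample path, the linear rewards of the windows are subject to the regret bound. -/
lemma pathwise_regret_le {p : ℝ≥0∞} {B : ℝ} {ys : ℕ → M.Coord → ℝ} (hL : 0 ≤ L)
    (hys : ys ∈ comparators p (M.shrunkSet δ) N B) {ω : Fin N → Seed M W}
    (hz : ∀ l, (ω l).z ∈ Set.Icc (0 : ℝ) 1) :
    ((∑ l : Fin N, (ys l - windowDecision P f ω l) ⬝ᵥ windowGrad P f ω l : ℝ) : EReal) ≤
      P.regret p N B := by
  -- The regret quantifies over infinite sequences in `R`; past the horizon the zero linear reward
  -- is used.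
  set ρ : ℕ → (M.Coord → ℝ) → ℝ := fun l =>
    if h : l < N then fun y => y ⬝ᵥ windowGrad P f ω ⟨l, h⟩ else fun y => y ⬝ᵥ 0 with hρ
  have hρl : ∀ (l : ℕ) (h : l < N), ρ l = fun y => y ⬝ᵥ windowGrad P f ω ⟨l, h⟩ := fun l h =>
    dif_pos h
  have hρR : ∀ l, ρ l ∈ R := by
    intro l
    by_cases h : l < N
    · rw [hρl l h]
      exact windowGrad_mem hδ hδV hf hR hz _
    · rw [hρ]
      simp only [h, dif_neg, not_false_eq_true]
      refine hR 0 ?_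
      have := ratio_pos
      rw [WithLp.toLp_zero, norm_zero]
      positivity
  -- Against the realized rewards, fixed in advance, the deterministic policy repeats its decisions,
  -- so their adaptivity is harmless.
  have hdec : ∀ (l : ℕ) (h : l < N), P.decision ρ l = windowDecision P f ω ⟨l, h⟩ := by
    intro l
    induction l using Nat.strong_induction_on with
    | _ l ih =>
      intro h
      rw [OCOPolicy.decision, windowDecision_eq]
      congr 1
      · funext s
        exact ih s s.2 _
      · funext s
        exact hρl s _
  have hval : ∑ l : Fin N, (ys l - windowDecision P f ω l) ⬝ᵥ windowGrad P f ω l =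
      ∑ l ∈ Finset.range N, ρ l (ys l) - ∑ l ∈ Finset.range N, ρ l (P.decision ρ l) := by
    rw [← Finset.sum_sub_distrib, Finset.sum_range]
    refine Finset.sum_congr rfl fun l _ => ?_
    rw [hdec l l.2, hρl l l.2, sub_dotProduct]
  rw [hval]
  exact le_iSup₂_of_le ρ hρR (le_iSup₂_of_le ys hys le_rfl)

end Bounds

lemma ae_z_mem [Nonempty (Fin W)] [Nonempty M.Coord] :
    ∀ᵐ ω ∂(Measure.pi fun _ : Fin N => seedLaw M W), ∀ l, (ω l).z ∈ Set.Icc (0 : ℝ) 1 :=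
  ae_all_iff.2 fun l =>
    (measurePreserving_eval (fun _ : Fin N => seedLaw M W) l).quasiMeasurePreserving.ae
      seedLaw_ae_z_mem

lemma norm_shrunk_sub_le (hδ : 0 < δ) (hδV : ∀ i, δ * (2 * M.partCard i) ≤ 1)
    {x y : M.Coord → ℝ} (hx : x ∈ M.shrunkSet δ) (hy : y ∈ M.shrunkSet δ) :
    ‖WithLp.toLp 2 (x - y)‖ ≤ ‖WithLp.toLp 2 (1 : M.Coord → ℝ)‖ := by
  have hle : ∀ {y : M.Coord → ℝ}, M.Feasible y → ∀ c, y c ≤ 1 := fun {y} hy c =>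
    (Finset.single_le_sum (f := y) (s := Finset.univ.filter fun c' => M.slot c' = M.slot c)
      (fun c _ => hy.1 c) (by simp)).trans (hy.2 (M.slot c))
  have hx' := feasible_of_mem_shrunkSet hδV hx hδ
  have hy' := feasible_of_mem_shrunkSet hδV hy hδ
  refine norm_toLp_le_of_injOn (by norm_num) id (fun c => ?_) Function.injective_id.injOn
  rw [Pi.sub_apply, id, Pi.one_apply, abs_one, abs_le]
  constructor <;> linarith [hx'.1 c, hy'.1 c, hle hx' c, hle hy' c]

/-! ### Averaging over sample paths -/

section Regret

variable {P f} [Nonempty M.Coord] [Nonempty (Fin W)] (hδ : 0 < δ)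
  (hδV : ∀ i, δ * (2 * M.partCard i) ≤ 1) {L : ℝ} (hf : ∀ t, f t ∈ M.rewards L)
include hδ hδV hf

omit hδ hδV in
lemma integrable_window_reward (l : Fin N) :
    Integrable (fun ω : Fin N → Seed M W =>
      ∑ i : Fin W, f (l * W + i) ((ω l).play δ (windowDecision P f ω l) i))
      (Measure.pi fun _ => seedLaw M W) := by
  refine integrable_finsetSum _ fun i _ => ?_
  refine Integrable.of_bound (Seed.measurable_play (measurable_pi_apply l)
    (measurable_windowDecision P f l) δ i _).aestronglyMeasurable (f (l * W + i) Finset.univ)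
    (Filter.Eventually.of_forall fun ω => ?_)
  rw [Real.norm_eq_abs, abs_of_nonneg ((hf _).2.2.1 _)]
  exact (hf _).1 (Finset.subset_univ _)

variable (hR : ∀ g : M.Coord → ℝ, ‖WithLp.toLp 2 g‖ ≤ 4 * ratio * M.dim ^ 2 * L / δ →
  (fun y => y ⬝ᵥ g) ∈ R)
include hR

lemma integrable_window_linear (l : Fin N) {x : M.Coord → ℝ} (hx : x ∈ M.shrunkSet δ) :
    Integrable (fun ω : Fin N → Seed M W =>
      (x - windowDecision P f ω l) ⬝ᵥ windowGrad P f ω l)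
      (Measure.pi fun _ => seedLaw M W) := by
  have hmeas : Measurable fun ω : Fin N → Seed M W =>
      (x - windowDecision P f ω l) ⬝ᵥ windowGrad P f ω l :=
    Finset.measurable_sum _ fun c _ =>
      (measurable_const.sub ((measurable_pi_apply c).comp (measurable_windowDecision P f l))).mul
        ((measurable_pi_apply c).comp (measurable_windowGrad P f l))
  refine Integrable.of_bound hmeas.aestronglyMeasurable
    (‖WithLp.toLp 2 (1 : M.Coord → ℝ)‖ *
      (4 * ratio * M.dim ^ 2 * (∑ j : Fin W, f (l * W + j) Finset.univ) / δ)) ?_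
  filter_upwards [ae_z_mem] with ω hz
  rw [Real.norm_eq_abs]
  refine (abs_dotProduct_gradEstimate_reward_le (f := fun i : Fin W => f (l * W + i)) hδ hδV
    (fun i => (hf _).1) (fun i => (hf _).2.2.1) (ω l) _ _).trans ?_
  refine mul_le_mul_of_nonneg_right
    (norm_shrunk_sub_le hδ hδV hx (windowDecision_mem hδ hδV hf hR hz l)) ?_
  have h1 := ratio_pos
  have h2 : 0 ≤ ∑ j : Fin W, f (l * W + j) Finset.univ :=
    Finset.sum_nonneg fun j _ => (hf _).2.2.1 _
  positivity

/-- Resampling the seed of the window `l` reduces the claim to `window_regret_le`, for almost every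
choice of the other seeds. -/
lemma expected_window_regret_le (hrank : 0 < M.rank) (l : Fin N) {A : Finset M.Coord}
    (hA : A ∈ M.lifted) (hinj : Set.InjOn Sigma.fst (A : Set M.Coord)) :
    ratio * ∑ i : Fin W, f (l * W + i) (M.merge A) ≤
      ∫ ω, ∑ i : Fin W, f (l * W + i) ((ω l).play δ (windowDecision P f ω l) i)
        ∂(Measure.pi fun _ : Fin N => seedLaw M W) +
      W * ∫ ω, (M.shrink δ (indVec A) - windowDecision P f ω l) ⬝ᵥ windowGrad P f ω l
        ∂(Measure.pi fun _ : Fin N => seedLaw M W) +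
      (L + W * (2 * ratio * δ * M.rank ^ 2 * n * L)) := by
  have hi1 := integrable_window_reward (P := P) (W := W) hf l
  have hi2 := integrable_window_linear (P := P) (W := W) hδ hδV hf hR l (shrink_indVec_mem hA)
  have hj1 := integrable_update l hi1
  have hj2 := integrable_update l hi2
  rw [integral_update l hi1, integral_update l hi2, ← integral_const_mul,
    ← integral_add hj1 (hj2.const_mul _), ← sub_le_iff_le_add]
  have hprob : ∫ _ω : Fin N → Seed M W, (ratio * ∑ i : Fin W, f (l * W + i) (M.merge A) -
      (L + W * (2 * ratio * δ * M.rank ^ 2 * n * L)))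
      ∂(Measure.pi fun _ : Fin N => seedLaw M W) =
      ratio * ∑ i : Fin W, f (l * W + i) (M.merge A) -
      (L + W * (2 * ratio * δ * M.rank ^ 2 * n * L)) := by
    rw [integral_const, probReal_univ, one_smul]
  rw [← hprob]
  refine integral_mono_ae (integrable_const _) (hj1.add (hj2.const_mul _)) ?_
  filter_upwards [ae_z_mem] with ω hz
  have hy := windowDecision_mem (P := P) hδ hδV hf hR hz l
  have h := window_regret_le (W := W) hrank hδ hδV hy (f := fun i : Fin W => f (l * W + i))
    (fun i => hf _) hA hinj
  rw [sub_le_iff_le_add]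
  simpa only [windowGrad, windowDecision_update P f ω l _ l le_rfl, Function.update_self] using h

end Regret

lemma sum_range_mul_eq (N W : ℕ) (h : ℕ → ℝ) :
    ∑ t ∈ Finset.range (N * W), h t = ∑ l : Fin N, ∑ i : Fin W, h (l * W + i) := by
  rw [Finset.sum_range, ← Equiv.sum_comp finProdFinEquiv, Fintype.sum_prod_type]
  refine Finset.sum_congr rfl fun l _ => Finset.sum_congr rfl fun i _ => ?_
  congr 1
  simp only [finProdFinEquiv_apply_val]
  ring

namespace PartitionMatroid

/-- Needed for the uniform laws on the sphere and on the coordinates to be probability measures. -/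
lemma nonempty_coord (hrank : 0 < M.rank) : Nonempty M.Coord := by
  by_contra h
  rw [not_nonempty_iff] at h
  refine hrank.not_ge (csSup_le' ?_)
  rintro _ ⟨S, hS, rfl⟩
  rw [nonpos_iff_eq_zero, Finset.card_eq_zero, Finset.eq_empty_iff_forall_notMem]
  intro k hk
  have h1 : 0 < M.cap (M.part k) :=
    lt_of_lt_of_le (Finset.card_pos.2 ⟨k, by simpa using hk⟩) (hS (M.part k))
  exact h.false ⟨k, ⟨0, h1⟩⟩

end PartitionMatroid

end LIRAOCO

end

/-! ### Summing over the windows -/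

open LIRAOCO LIRAOCO.PartitionMatroid in
theorem theorem6 {n m : ℕ} (M : LIRAOCO.PartitionMatroid n m) (hM : 0 < M.rank)
    (L : ℝ) (hL : 0 ≤ L)
    (δ : ℝ) (hδ : 0 < δ) (hδV : ∀ i, δ * (2 * M.partCard i) ≤ 1)
    (T W : ℕ) (hW : 0 < W) (hT : W ∣ T)
    (p : ℝ≥0∞) (hp : 1 ≤ p) (B : ℝ) (hB : 0 ≤ B)
    (R : Set ((M.Coord → ℝ) → ℝ))
    (hR : ∀ g : M.Coord → ℝ, ‖WithLp.toLp 2 g‖ ≤ 4 * LIRAOCO.ratio * M.dim ^ 2 * L / δ →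
      (fun y => y ⬝ᵥ g) ∈ R)
    (P : LIRAOCO.OCOPolicy (M.shrunkSet δ) R) :
    LIRAOCO.alphaRegret P L p T W B ≤
      ((W : ℝ) : EReal) * P.regret p (T / W) B +
        ((L * (T / W) + 2 * LIRAOCO.ratio * δ * M.rank ^ 2 * n * L * T : ℝ) : EReal) := by
  have := nonempty_coord hM
  have : Nonempty (Fin W) := ⟨⟨0, hW⟩⟩
  have hTN : T / W * W = T := Nat.div_mul_cancel hT
  have hcast : (T : ℝ) / W = ((T / W : ℕ) : ℝ) := (Nat.cast_div hT (by positivity)).symm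
  have hcastT : (T : ℝ) = ((T / W : ℕ) : ℝ) * W := by exact_mod_cast hTN.symm
  refine iSup₂_le fun f hf => iSup₂_le fun x hx => ?_
  obtain ⟨hxM, hxB, hxW⟩ := hx
  set N := T / W with hN
  have hlt : ∀ l < N, ∀ i < W, l * W + i < T := by
    intro l hl i hi
    rw [← hTN]
    calc l * W + i < l * W + W := by omega
      _ = (l + 1) * W := by ring
      _ ≤ N * W := Nat.mul_le_mul_right _ hl
  obtain ⟨A, hA⟩ := exists_lift_sequence (M := M) N (fun l => x (l * W)) fun l hl =>
    hxM _ (by simpa using hlt l hl 0 hW)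
  have hys : (fun l => M.shrink δ (indVec (A l))) ∈ comparators p (M.shrunkSet δ) N B := by
    refine ⟨fun l hl => shrink_indVec_mem (hA l hl).1, le_trans ?_ hxB⟩
    have h1 := pathLength_subsample_le (x := fun t => indVec (x t)) hp (N := N) hW
      fun t ht t' ht' h => by rw [hxW t (hTN ▸ ht) t' (hTN ▸ ht') h]
    rw [hTN] at h1
    refine le_trans (Finset.sum_le_sum fun l hl => ?_) h1
    have hl' : l + 1 < N := by
      have := Finset.mem_range.1 hl
      omega
    have h2 := hA l (by omega)
    have h3 := hA (l + 1) hl'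
    have h4 := norm_shrink_sub_le hp hδ hδV h2.2.1 h3.2.1 fun c hc hcA =>
      h3.2.2.2 (by omega) c hc (h3.2.2.1 ▸ hcA)
    rwa [h2.2.2.1, h3.2.2.1] at h4
  have hae : ∀ᵐ ω ∂(Measure.pi fun _ : Fin N => seedLaw M W),
      ((∑ l : Fin N, (M.shrink δ (indVec (A l)) - windowDecision P f ω l) ⬝ᵥ
        windowGrad P f ω l : ℝ) : EReal) ≤ P.regret p N B := by
    filter_upwards [ae_z_mem] with ω hz
    exact pathwise_regret_le hδ hδV hf hR hL hys hz
  have hcore : ∀ r : ℝ, P.regret p N B = r →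
      ratio * ∑ t ∈ Finset.range T, f t (x t) - expectedReward P T W f ≤
        W * r + (L * (T / W) + 2 * ratio * δ * M.rank ^ 2 * n * L * T) := by
    intro r hr
    have hI : ∫ ω, ∑ l : Fin N, (M.shrink δ (indVec (A l)) - windowDecision P f ω l) ⬝ᵥ
        windowGrad P f ω l ∂(Measure.pi fun _ : Fin N => seedLaw M W) ≤ r := by
      have h1 : ∫ _ω : Fin N → Seed M W, r ∂(Measure.pi fun _ : Fin N => seedLaw M W) = r := by
        rw [integral_const, probReal_univ, one_smul]
      refine le_of_le_of_eq (integral_mono_ae (integrable_finsetSum _ fun l _ =>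
        integrable_window_linear hδ hδV hf hR l (shrink_indVec_mem (hA l l.2).1))
        (integrable_const r) ?_) h1
      filter_upwards [hae] with ω hω
      rw [hr] at hω
      exact EReal.coe_le_coe_iff.1 hω
    rw [integral_finsetSum _ fun l _ =>
      integrable_window_linear hδ hδV hf hR l (shrink_indVec_mem (hA l l.2).1)] at hI
    have hE : expectedReward P T W f = ∑ l : Fin N,
        ∫ ω, ∑ i : Fin W, f (l * W + i) ((ω l).play δ (windowDecision P f ω l) i)
          ∂(Measure.pi fun _ : Fin N => seedLaw M W) :=
      integral_finsetSum _ fun l _ => integrable_window_reward hf l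
    have hsum : ∑ t ∈ Finset.range T, f t (x t) =
        ∑ l : Fin N, ∑ i : Fin W, f (l * W + i) (M.merge (A l)) := by
      rw [← hTN, sum_range_mul_eq]
      refine Finset.sum_congr rfl fun l _ => Finset.sum_congr rfl fun i _ => ?_
      rw [(hA l l.2).2.2.1]
      congr 1
      refine hxW _ (hlt l l.2 i i.2) _ (by simpa using hlt l l.2 0 hW) ?_
      rw [Nat.mul_div_cancel _ hW, Nat.add_comm, Nat.add_mul_div_right _ _ hW,
        Nat.div_eq_of_lt i.2, zero_add]
    have hw := Finset.sum_le_sum fun l (_ : l ∈ Finset.univ) =>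
      expected_window_regret_le (P := P) (W := W) hδ hδV hf hR hM l (hA l l.2).1 (hA l l.2).2.1
    rw [← Finset.mul_sum, Finset.sum_add_distrib, Finset.sum_add_distrib, ← Finset.mul_sum,
      Finset.sum_const, Finset.card_univ, Fintype.card_fin, nsmul_eq_mul] at hw
    rw [hsum, hE, hcast, hcastT]
    have := mul_le_mul_of_nonneg_left hI (Nat.cast_nonneg (α := ℝ) W)
    linarith
  -- A single good sample path bounds the regret of the policy below by a real number, which
  -- excludes `⊥`; for `⊤` the claim is trivial as `W > 0`.
  obtain ⟨ω, hω⟩ := hae.exists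
  have hWpos : (0 : ℝ) < W := by positivity
  induction hreg : P.regret p N B using EReal.rec with
  | bot =>
    rw [hreg] at hω
    exact absurd (le_bot_iff.1 hω) (EReal.coe_ne_bot _)
  | top =>
    rw [EReal.coe_mul_top_of_pos hWpos, EReal.top_add_coe]
    exact le_top
  | coe r =>
    have := hcore r hreg
    exact_mod_cast this
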